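/- Let $p$ be an odd prime and let $G$ be a (topologically) finitely generated pro-$p$ group. For a closed subgroup $N$ of $G$ and $n\ge 1$ let $N^n$ denote the closed subgroup generated by the $n$-th powers of the elements of $N$. A closed normal subgroup $N$ of a pro-$p$ group $H$ is powerfully embedded in $H$ if $[N,H]\le N^p$, and $\eta(H)$ denotes the closed product of all powerfully embedded closed normal subgroups of $H$. The upper $\eta$-series of $G$ is defined by $\eta_0(G)=1$ and $\eta_{j+1}(G)/\eta_j(G)=\eta(G/\eta_j(G))$ for $j\ge 0$, and $G$ has powerful class $k$ if $k$ is the smallest non-negative integer with $\eta_k(G)=G$. For $i\ge 0$ let $\Omega_i(G)$ be the closed subgroup of $G$ generated by all $x\in G$ with $x^{p^i}=1$. Suppose that $G$ has powerful class $k$, and let $\ell\ge 0$ be an integer with $k\le \ell(p-1)$. Then $\Omega_i(G)^{p^{i+\ell}}=1$ for every $i\ge 0$. -/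

import Mathlib

/-- `G` is a pro-`p` group: a compact Hausdorff totally disconnected topological group all of whose
open normal subgroups have index a power of `p`. -/
structure IsProPGroup (p : ℕ) (G : Type*) [Group G] [TopologicalSpace G]
    [IsTopologicalGroup G] : Prop where
  compactSpace : CompactSpace G
  t2Space : T2Space G
  totallyDisconnectedSpace : TotallyDisconnectedSpace G
  index_eq_pow : ∀ U : Subgroup G, U.Normal → IsOpen (U : Set G) → ∃ n : ℕ, U.index = p ^ n

/-- `G` is finitely generated as a topological group: some finite subset generates a dense
subgroup. -/
def IsTopologicallyFinitelyGenerated (G : Type*) [Group G] [TopologicalSpace G] : Prop :=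
  ∃ S : Finset G, Dense (Subgroup.closure (S : Set G) : Set G)

/-- `N ^ n`: the closed subgroup generated by the `n`-th powers of the elements of `N`. -/
def Subgroup.closedPower {G : Type*} [Group G] [TopologicalSpace G] [IsTopologicalGroup G]
    (N : Subgroup G) (n : ℕ) : Subgroup G :=
  (Subgroup.closure ((fun x : G => x ^ n) '' (N : Set G))).topologicalClosure

/-- `N` is a closed normal subgroup of `G` that is powerfully embedded in `G` (for odd `p`), that is,
`[N, G] ≤ N ^ p`. As `N ^ p` is closed, it is immaterial whether `[N, G]` is closed up. -/
structure IsPowerfullyEmbedded (p : ℕ) {G : Type*} [Group G] [TopologicalSpace G]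
    [IsTopologicalGroup G] (N : Subgroup G) : Prop where
  normal : N.Normal
  isClosed : IsClosed (N : Set G)
  commutator_le : ⁅N, (⊤ : Subgroup G)⁆ ≤ N.closedPower p

/-- `η(G)`: the closed product of all powerfully embedded closed normal subgroups of `G`. -/
def etaSubgroup (p : ℕ) (G : Type*) [Group G] [TopologicalSpace G] [IsTopologicalGroup G] :
    Subgroup G :=
  (sSup {N : Subgroup G | IsPowerfullyEmbedded p N}).topologicalClosure

theorem etaSubgroup_normal (p : ℕ) (G : Type*) [Group G] [TopologicalSpace G]
    [IsTopologicalGroup G] : (etaSubgroup p G).Normal := by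
  have : (sSup {N : Subgroup G | IsPowerfullyEmbedded p N}).Normal :=
    Subgroup.sSup_normal _ fun _ hN => hN.normal
  exact Subgroup.is_normal_topologicalClosure _

/-- One step of the upper `η`-series: the preimage in `G` of `η(G / N)`. -/
def etaStep (p : ℕ) {G : Type*} [Group G] [TopologicalSpace G] [IsTopologicalGroup G]
    (N : Subgroup G) [N.Normal] : Subgroup G :=
  (etaSubgroup p (G ⧸ N)).comap (QuotientGroup.mk' N)

/-- The upper `η`-series of `G`, with normality of its terms bundled:
`η_0(G) = 1` and `η_{i+1}(G) / η_i(G) = η(G / η_i(G))`. -/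
def upperEtaSeriesAux (p : ℕ) (G : Type*) [Group G] [TopologicalSpace G] [IsTopologicalGroup G] :
    ℕ → {N : Subgroup G // N.Normal}
  | 0 => ⟨⊥, inferInstance⟩
  | i + 1 =>
    haveI := (upperEtaSeriesAux p G i).2
    ⟨etaStep p (upperEtaSeriesAux p G i).1, (etaSubgroup_normal p _).comap _⟩

/-- `η_i(G)`, the `i`-th term of the upper `η`-series of `G`. -/
def upperEtaSeries (p : ℕ) (G : Type*) [Group G] [TopologicalSpace G] [IsTopologicalGroup G]
    (i : ℕ) : Subgroup G :=
  (upperEtaSeriesAux p G i).1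

/-- `G` has powerful class `k`: `k` is the smallest natural number with `η_k(G) = G`. -/
def HasPowerfulClass (p : ℕ) (G : Type*) [Group G] [TopologicalSpace G] [IsTopologicalGroup G]
    (k : ℕ) : Prop :=
  IsLeast {j : ℕ | upperEtaSeries p G j = ⊤} k

/-- `Ω_i(G)`: the closed subgroup generated by all `x` in `G` with `x ^ (p ^ i) = 1`. -/
def omegaSubgroup (p : ℕ) (G : Type*) [Group G] [TopologicalSpace G] [IsTopologicalGroup G]
    (i : ℕ) : Subgroup G :=
  (Subgroup.closure {x : G | x ^ p ^ i = 1}).topologicalClosure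

/-! ### Polynomial sequences and the Hall–Petrescu congruence -/

/-! It suffices to bound `x ^ p ^ (i + ℓ)` in every finite quotient by an open normal subgroup.
There the `η`-series becomes a normal chain `Q j` from `1` to the group in `k` steps, with `[Q
(j+1), G] ≤ (Q (j+1))^p Q j`. Descending along the chain and absorbing the `Q j` one at a time
(`exists_powerfullyEmbedded_of_chain`) gives one powerfully embedded `P` with `γ_{k+1}(G) ≤ P^p`.

Put `J 1 = G` and let `J a`, for `a ≥ 2`, be the `(a-1)`-fold iterated `p`-th power subgroup of `P`.
Commutators add degrees, and elements of `J (a+1)` are `p`-th powers from `J a`. Downward induction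
on `b + c` (`IsPowerFiltration.commutator_torsion`) shows that `[x, y]`, with `x ∈ J b`, `b ≥ 2` and
`y ∈ J c`, is killed by any power of `p` killing `y`; torsion elements deeper in `J` give even
smaller orders.

Let `H` be generated by the elements killed by `p^i`. From `γ_{k+2}(H)` on, each further commutator
lowers the exponent by one factor `p`, starting from `p^i`. Going back up, `γ_{n+1}(H)` is killed by
`p^(i+ℓ-⌊n/(p-1)⌋)`, and `n = 0` is the claim. The loss rate `1/(p-1)` comes from binomial
coefficients: the valuation of `C(p^N, n+1)` is at least `N - v` with `(p-1)v ≤ n`. All power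
computations rest on one Hall–Petrescu congruence, proved with polynomial sequences. -/

namespace PowerfulClass

open scoped commutatorElement

section PolySeq

variable {G : Type*} [Group G]

/-- The first `r` iterated differences of `f` take values in the corresponding terms of the
filtration `K`, starting from `K d`. -/
def IsPolySeq (K : ℕ → Subgroup G) : ℕ → ℕ → (ℕ → G) → Prop
  | 0, d, f => ∀ n, f n ∈ K d
  | r + 1, d, f => (∀ n, f n ∈ K d) ∧ IsPolySeq K r (d + 1) fun n => (f n)⁻¹ * f (n + 1)

variable {K : ℕ → Subgroup G}

theorem IsPolySeq.mem {r d : ℕ} {f : ℕ → G} (hf : IsPolySeq K r d f) (n : ℕ) : f n ∈ K d := by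
  cases r with
  | zero => exact hf n
  | succ r => exact hf.1 n

theorem IsPolySeq.of_succ {r d : ℕ} {f : ℕ → G} (hf : IsPolySeq K (r + 1) d f) :
    IsPolySeq K r d f := by
  induction r generalizing d f with
  | zero => exact hf.1
  | succ r ih => exact ⟨hf.1, ih hf.2⟩

theorem IsPolySeq.mono (hK : Antitone K) {r d e : ℕ} (hde : d ≤ e) {f : ℕ → G}
    (hf : IsPolySeq K r e f) : IsPolySeq K r d f := by
  induction r generalizing d e f with
  | zero => exact fun n => hK hde (hf n)
  | succ r ih => exact ⟨fun n => hK hde (hf.1 n), ih (Nat.succ_le_succ hde) hf.2⟩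

theorem isPolySeq_one (r d : ℕ) : IsPolySeq K r d fun _ => 1 := by
  induction r generalizing d with
  | zero => exact fun n => one_mem _
  | succ r ih => exact ⟨fun n => one_mem _, by simpa using ih (d + 1)⟩

/-- The three closure properties need a joint induction: the difference of a product is `⁅g⁻¹, Δf⁆
Δf Δg`, and differences of inverses and commutators likewise expand into products and commutators of
sequences with one difference fewer to control. -/
theorem isPolySeq_closed (hK : Antitone K) (hc : ∀ a b, ⁅K a, K b⁆ ≤ K (a + b)) (r : ℕ) :
    (∀ d f g, IsPolySeq K r d f → IsPolySeq K r d g → IsPolySeq K r d fun n => f n * g n) ∧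
    (∀ d f, IsPolySeq K r d f → IsPolySeq K r d fun n => (f n)⁻¹) ∧
    (∀ d e f g, IsPolySeq K r d f → IsPolySeq K r e g →
      IsPolySeq K r (d + e) fun n => ⁅f n, g n⁆) := by
  induction r with
  | zero =>
    refine ⟨fun d f g hf hg n => mul_mem (hf n) (hg n), fun d f hf n => inv_mem (hf n),
      fun d e f g hf hg n => hc d e (Subgroup.commutator_mem_commutator (hf n) (hg n))⟩
  | succ r ih =>
    obtain ⟨hmul, hinv, hcom⟩ := ih
    refine ⟨fun d f g hf hg => ⟨fun n => mul_mem (hf.1 n) (hg.1 n), ?_⟩,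
      fun d f hf => ⟨fun n => inv_mem (hf.1 n), ?_⟩,
      fun d e f g hf hg => ⟨fun n =>
        hc d e (Subgroup.commutator_mem_commutator (hf.1 n) (hg.1 n)), ?_⟩⟩
    · have h1 := hmul _ _ _ (hmul _ _ _ ((hcom _ _ _ _ (hinv _ _ hg.of_succ) hf.2).mono hK
        (by omega : d + 1 ≤ d + (d + 1))) hf.2) hg.2
      convert h1 using 2 with n
      simp only [commutatorElement_def]; group
    · have h1 := hmul _ _ _ ((hcom _ _ _ _ hf.of_succ (hinv _ _ hf.2)).mono hK
        (by omega : d + 1 ≤ d + (d + 1))) (hinv _ _ hf.2)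
      convert h1 using 2 with n
      simp only [commutatorElement_def]; group
    · set a : ℕ → G := fun n => (f n)⁻¹ * f (n + 1) with ha
      set b : ℕ → G := fun n => (g n)⁻¹ * g (n + 1) with hb
      have hgb := hmul _ _ _ hg.of_succ (hg.2.mono hK (Nat.le_succ e))
      have h1 := hcom _ _ _ _ hf.2 hgb
      have h2 := hcom _ _ _ _ hf.of_succ hg.2
      have hX := hmul _ _ _ ((hcom _ _ _ _ hf.of_succ h1).mono hK
        (by omega : d + e + 1 ≤ d + (d + 1 + e))) (h1.mono hK (by omega : d + e + 1 ≤ d + 1 + e))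
      have hY := hmul _ _ _ ((hcom _ _ _ _ hg.of_succ h2).mono hK
        (by omega : d + e + 1 ≤ e + (d + (e + 1)))) (h2.mono hK (by omega : d + e + 1 ≤ d + (e + 1)))
      have hw := hcom _ _ _ _ hf.of_succ hg.of_succ
      have h3 := hmul _ _ _ (hmul _ _ _ ((hcom _ _ _ _ (hinv _ _ hw) hX).mono hK
        (by omega : d + e + 1 ≤ d + e + (d + e + 1))) hX) hY
      convert h3 using 2 with n
      simp only [commutatorElement_def]; group

/-- A sequence all of whose iterated differences lie in the filtration. -/
def IsPoly (K : ℕ → Subgroup G) (d : ℕ) (f : ℕ → G) : Prop := ∀ r, IsPolySeq K r d f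

theorem IsPoly.mul (hK : Antitone K) (hc : ∀ a b, ⁅K a, K b⁆ ≤ K (a + b)) {d : ℕ} {f g : ℕ → G}
    (hf : IsPoly K d f) (hg : IsPoly K d g) : IsPoly K d fun n => f n * g n :=
  fun r => (isPolySeq_closed hK hc r).1 _ _ _ (hf r) (hg r)

theorem IsPoly.inv (hK : Antitone K) (hc : ∀ a b, ⁅K a, K b⁆ ≤ K (a + b)) {d : ℕ} {f : ℕ → G}
    (hf : IsPoly K d f) : IsPoly K d fun n => (f n)⁻¹ :=
  fun r => (isPolySeq_closed hK hc r).2.1 _ _ (hf r)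

theorem isPolySeq_pow_choose {j : ℕ} {g : G} (i d : ℕ) (hij : i + d = j) (hK : Antitone K)
    (hg : g ∈ K j) (r : ℕ) : IsPolySeq K r d fun n => g ^ n.choose i := by
  induction r generalizing i d with
  | zero => exact fun n => pow_mem (hK (by omega : d ≤ j) hg) _
  | succ r ih =>
    refine ⟨fun n => pow_mem (hK (by omega : d ≤ j) hg) _, ?_⟩
    cases i with
    | zero => simpa using isPolySeq_one r (d + 1)
    | succ i =>
      convert ih i (d + 1) (by omega) using 2 with n
      simp only
      rw [Nat.choose_succ_succ', add_comm (n.choose i), pow_add, inv_mul_cancel_left]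

theorem isPoly_pow_choose (hK : Antitone K) {j : ℕ} {g : G} (hg : g ∈ K j) :
    IsPoly K 0 fun n => g ^ n.choose j :=
  isPolySeq_pow_choose j 0 (by simp) hK hg

theorem IsPolySeq.mem_of_vanish {j r d : ℕ} {f : ℕ → G} (hf : IsPolySeq K r d f) (hjr : j ≤ r)
    {a : ℕ} (h0 : ∀ n < j, f (a + n) = 1) : f (a + j) ∈ K (d + j) := by
  induction j generalizing r d f a with
  | zero => exact hf.mem _
  | succ j ih =>
    obtain ⟨r, rfl⟩ : ∃ s, r = s + 1 := ⟨r - 1, by omega⟩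
    have := ih hf.2 (by omega) (a := a) (fun n hn => by
      rw [h0 n (by omega), add_assoc, h0 (n + 1) (by omega)]; simp)
    rw [h0 j (by omega)] at this
    simpa [add_assoc, add_comm, add_left_comm] using this

/-- A polynomial sequence vanishing at the first `j` points takes at `N` a value which is a product
of binomial powers of elements of the filtration. -/
theorem IsPoly.mem_of_vanish (hK : Antitone K) (hc : ∀ a b, ⁅K a, K b⁆ ≤ K (a + b))
    {N : ℕ} {Q : Subgroup G} {j₀ : ℕ} (hQ : ∀ n, j₀ ≤ n → ∀ g ∈ K n, g ^ N.choose n ∈ Q)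
    (i j : ℕ) (hj : j₀ ≤ j) (hij : N < j + i) {f : ℕ → G} (hf : IsPoly K 0 f)
    (h0 : ∀ n < j, f n = 1) : f N ∈ Q := by
  induction i generalizing j f with
  | zero => rw [h0 N (by omega)]; exact one_mem _
  | succ i ih =>
    have hg : f j ∈ K j := by
      simpa using (hf j).mem_of_vanish le_rfl (a := 0) (by simpa using h0)
    -- Dividing by `n ↦ (f j) ^ n.choose j` keeps the zeros below `j` and adds one at `j`. Repeating
    -- until the zeros pass `N` writes `f N` as a product of binomial powers.
    have h1 := ih (j + 1) (by omega) (by omega)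
      (((isPoly_pow_choose hK hg).inv hK hc).mul hK hc hf) (fun n hn => by
        rcases Nat.lt_succ_iff_lt_or_eq.1 hn with h | rfl
        · rw [h0 n h, Nat.choose_eq_zero_of_lt h]; simp
        · simp)
    have h2 := mul_mem (hQ j hj _ hg) h1
    simpa using h2

end PolySeq

/-! ### The Hall–Petrescu congruence along the lower central series -/

section HallPetrescu

variable {G : Type*} [Group G]

theorem commutator_commutator_le_of_rotate {A B C W : Subgroup G} [W.Normal]
    (h1 : ⁅⁅B, C⁆, A⁆ ≤ W) (h2 : ⁅⁅C, A⁆, B⁆ ≤ W) : ⁅⁅A, B⁆, C⁆ ≤ W := by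
  have key : ∀ X : Subgroup G, X ≤ W ↔ X.map (QuotientGroup.mk' W) = ⊥ := fun X => by
    rw [Subgroup.map_eq_bot_iff, QuotientGroup.ker_mk']
  rw [key, Subgroup.map_commutator, Subgroup.map_commutator] at *
  exact Subgroup.commutator_commutator_eq_bot_of_rotate h1 h2

theorem commutator_lowerCentralSeries_le (a b : ℕ) :
    ⁅(⊤ : Subgroup G).lowerCentralSeries a, (⊤ : Subgroup G).lowerCentralSeries b⁆ ≤
      (⊤ : Subgroup G).lowerCentralSeries (a + b + 1) := by
  induction b generalizing a with
  | zero => exact le_rfl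
  | succ b ih =>
    rw [Subgroup.commutator_comm, Subgroup.lowerCentralSeries_succ _ b]
    refine commutator_commutator_le_of_rotate ?_ ?_
    · rw [Subgroup.commutator_comm ⊤, ← Subgroup.lowerCentralSeries_succ]
      convert ih (a + 1) using 2; omega
    · exact Subgroup.commutator_mono (ih a) le_rfl

/-- The sequence `z⁻ⁿ x⁻ⁿ (xz)ⁿ` is polynomial for the filtration `G, G, γ₂, γ₃, …` and vanishes at
`0` and `1`, so only binomial powers of index at least `2` occur. -/
theorem hallPetrescu_top {N : ℕ} {Q : Subgroup G}
    (hQ : ∀ n, 1 ≤ n → ∀ g ∈ (⊤ : Subgroup G).lowerCentralSeries n, g ^ N.choose (n + 1) ∈ Q)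
    (x z : G) : z⁻¹ ^ N * x⁻¹ ^ N * (x * z) ^ N ∈ Q := by
  let K : ℕ → Subgroup G := fun n => (⊤ : Subgroup G).lowerCentralSeries (n - 1)
  have hK : Antitone K := fun a b hab => Subgroup.lowerCentralSeries_antitone _ (by omega)
  have hc : ∀ a b, ⁅K a, K b⁆ ≤ K (a + b) := fun a b => by
    rcases Nat.eq_zero_or_pos a with rfl | ha
    · refine (Subgroup.commutator_le_right _ _).trans (hK (by omega))
    rcases Nat.eq_zero_or_pos b with rfl | hb
    · refine (Subgroup.commutator_le_left _ _).trans (hK (by omega))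
    refine (commutator_lowerCentralSeries_le _ _).trans
      (Subgroup.lowerCentralSeries_antitone _ (by omega))
  have hp : ∀ g : G, IsPoly K 0 fun n => g ^ n := fun g => by
    simpa using isPoly_pow_choose hK (j := 1) (g := g) (by simp [K])
  refine IsPoly.mem_of_vanish hK hc (j₀ := 2) (fun n hn g hg => ?_) (N + 1) 2 le_rfl (by omega)
    (((hp z⁻¹).mul hK hc (hp x⁻¹)).mul hK hc (hp (x * z))) (fun n hn => ?_)
  · obtain ⟨m, rfl⟩ : ∃ m, n = m + 1 := ⟨n - 1, by omega⟩
    exact hQ m (by omega) g hg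
  · interval_cases n <;> simp

/-- A form of the Hall–Petrescu formula: modulo the binomial powers of the terms of the lower
central series of `T`, taking `N`-th powers is multiplicative on `T`. -/
theorem hallPetrescu {T Q : Subgroup G} {N : ℕ}
    (hQ : ∀ n, 1 ≤ n → ∀ g ∈ T.lowerCentralSeries n, g ^ N.choose (n + 1) ∈ Q)
    {x z : G} (hx : x ∈ T) (hz : z ∈ T) : z⁻¹ ^ N * x⁻¹ ^ N * (x * z) ^ N ∈ Q := by
  have := hallPetrescu_top (G := T) (N := N) (Q := Q.subgroupOf T) (fun n hn g hg => by
    rw [Subgroup.mem_subgroupOf]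
    have h : (g : G) ∈ T.lowerCentralSeries n := by
      rw [← Subgroup.top_subtype_lowerCentralSeries]
      exact ⟨g, hg, rfl⟩
    simpa using hQ n hn g h) ⟨x, hx⟩ ⟨z, hz⟩
  simpa [Subgroup.mem_subgroupOf] using this

theorem mul_pow_of_hallPetrescu {T : Subgroup G} {N : ℕ}
    (hQ : ∀ n, 1 ≤ n → ∀ g ∈ T.lowerCentralSeries n, g ^ N.choose (n + 1) = 1)
    {x z : G} (hx : x ∈ T) (hz : z ∈ T) : (x * z) ^ N = x ^ N * z ^ N := by
  have := hallPetrescu (Q := ⊥) (fun n hn g hg => Subgroup.mem_bot.2 (hQ n hn g hg)) hx hz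
  rw [Subgroup.mem_bot, inv_pow, inv_pow, ← mul_inv_rev] at this
  exact (inv_mul_eq_one.1 this).symm

end HallPetrescu

/-! ### Powerfully embedded subgroups of finite `p`-groups -/

section PowerSubgroup

variable {G : Type*} [Group G]

/-- The subgroup generated by the `n`-th powers of the elements of `A`. -/
def powerSubgroup (n : ℕ) (A : Subgroup G) : Subgroup G :=
  Subgroup.closure ((fun x : G => x ^ n) '' (A : Set G))

theorem pow_mem_powerSubgroup {n : ℕ} {A : Subgroup G} {x : G} (hx : x ∈ A) :
    x ^ n ∈ powerSubgroup n A :=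
  Subgroup.subset_closure ⟨x, hx, rfl⟩

theorem powerSubgroup_le_iff {n : ℕ} {A B : Subgroup G} :
    powerSubgroup n A ≤ B ↔ ∀ x ∈ A, x ^ n ∈ B := by
  simp [powerSubgroup, Subgroup.closure_le, Set.subset_def]

theorem powerSubgroup_le_self (n : ℕ) (A : Subgroup G) : powerSubgroup n A ≤ A :=
  powerSubgroup_le_iff.2 fun _ hx => pow_mem hx n

theorem powerSubgroup_mono (n : ℕ) {A B : Subgroup G} (h : A ≤ B) :
    powerSubgroup n A ≤ powerSubgroup n B :=
  powerSubgroup_le_iff.2 fun _ hx => pow_mem_powerSubgroup (h hx)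

theorem map_powerSubgroup {H : Type*} [Group H] (f : G →* H) (n : ℕ) (A : Subgroup G) :
    (powerSubgroup n A).map f = powerSubgroup n (A.map f) := by
  rw [powerSubgroup, powerSubgroup, MonoidHom.map_closure, Set.image_image]
  congr 1
  ext y
  simp

theorem powerSubgroup_normal (n : ℕ) {A : Subgroup G} (hA : A.Normal) :
    (powerSubgroup n A).Normal := by
  constructor
  intro x hx g
  have h : (powerSubgroup n A).map (MulAut.conj g).toMonoidHom ≤ powerSubgroup n A := by
    rw [map_powerSubgroup]
    refine powerSubgroup_mono n ?_
    rintro _ ⟨y, hy, rfl⟩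
    exact hA.conj_mem y hy g
  exact h ⟨x, hx, rfl⟩

theorem commutatorElement_mem_of_mem_closure {S : Set G} {W : Subgroup G} (hW : W.Normal) {c : G}
    (h : ∀ s ∈ S, ⁅s, c⁆ ∈ W) {g : G} (hg : g ∈ Subgroup.closure S) : ⁅g, c⁆ ∈ W := by
  induction hg using Subgroup.closure_induction with
  | mem x hx => exact h x hx
  | one => simp
  | mul x y _ _ hx hy =>
    have : ⁅x * y, c⁆ = x * ⁅y, c⁆ * x⁻¹ * ⁅x, c⁆ := by
      simp only [commutatorElement_def]; group
    rw [this]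
    exact mul_mem (hW.conj_mem _ hy x) hx
  | inv x _ hx =>
    have : ⁅x⁻¹, c⁆ = x⁻¹ * ⁅x, c⁆⁻¹ * x⁻¹⁻¹ := by
      simp only [commutatorElement_def]; group
    rw [this]
    exact hW.conj_mem _ (inv_mem hx) _

/-- To bound a commutator subgroup by a normal subgroup, generators suffice. -/
theorem commutator_closure_le {S : Set G} {C W : Subgroup G} (hW : W.Normal)
    (h : ∀ s ∈ S, ∀ c ∈ C, ⁅s, c⁆ ∈ W) : ⁅Subgroup.closure S, C⁆ ≤ W :=
  Subgroup.commutator_le.2 fun _ hg c hc =>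
    commutatorElement_mem_of_mem_closure hW (fun s hs => h s hs c hc) hg

theorem commutator_sup_le {A B C W : Subgroup G} (hW : W.Normal) (hA : ⁅A, C⁆ ≤ W)
    (hB : ⁅B, C⁆ ≤ W) : ⁅A ⊔ B, C⁆ ≤ W := by
  rw [Subgroup.sup_eq_closure]
  refine commutator_closure_le hW ?_
  rintro s (hs | hs) c hc
  exacts [hA (Subgroup.commutator_mem_commutator hs hc),
    hB (Subgroup.commutator_mem_commutator hs hc)]

/-- In a nilpotent group it is enough to compare normal subgroups `X` and `Y` modulo `[X, G]`. -/
theorem le_of_le_sup_commutator [Group.IsNilpotent G] {X Y : Subgroup G} (hY : Y.Normal)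
    (h : X ≤ Y ⊔ ⁅X, (⊤ : Subgroup G)⁆) : X ≤ Y := by
  have key : ∀ n, X ≤ Y ⊔ (⊤ : Subgroup G).lowerCentralSeries n := fun n => by
    induction n with
    | zero => simp
    | succ n ih =>
      refine h.trans (sup_le le_sup_left ?_)
      refine (Subgroup.commutator_mono ih le_rfl).trans
        (commutator_sup_le inferInstance ?_ ?_)
      · exact (Subgroup.commutator_le_left _ _).trans le_sup_left
      · exact le_sup_right
  obtain ⟨n, hn⟩ := (Subgroup.nilpotent_iff_lowerCentralSeries (G := G)).1 inferInstance
  simpa [hn] using key n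

theorem mul_pow_of_commutator_central {c n : G} (he : ⁅n, c⁆ ∈ Subgroup.center G) (k : ℕ) :
    (c * n) ^ k = ⁅n, c⁆ ^ k.choose 2 * c ^ k * n ^ k := by
  set e := ⁅n, c⁆ with hedef
  have hz : ∀ g m, g * e ^ m = e ^ m * g := fun g m =>
    Subgroup.mem_center_iff.1 (pow_mem he m) g
  have h1 : n * c = e * (c * n) := by rw [hedef, commutatorElement_def]; group
  have h2 : ∀ m, n ^ m * c = e ^ m * (c * n ^ m) := fun m => by
    induction m with
    | zero => simp
    | succ m ih =>
      calc n ^ (m + 1) * c = n * (n ^ m * c) := by rw [pow_succ', mul_assoc]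
        _ = n * e ^ m * c * n ^ m := by rw [ih]; group
        _ = e ^ m * (n * c) * n ^ m := by rw [hz]; group
        _ = e ^ (m + 1) * (c * n ^ (m + 1)) := by rw [h1, pow_succ e, pow_succ' n]; group
  induction k with
  | zero => simp
  | succ k ih =>
    calc (c * n) ^ (k + 1) = e ^ k.choose 2 * c ^ k * (n ^ k * c) * n := by
          rw [pow_succ, ih]; group
      _ = e ^ k.choose 2 * (c ^ k * e ^ k) * c * n ^ k * n := by rw [h2]; group
      _ = e ^ (k + 1).choose 2 * c ^ (k + 1) * n ^ (k + 1) := by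
          rw [hz, Nat.choose_succ_succ' k 1, Nat.choose_one_right, add_comm k, pow_add, pow_succ c,
            pow_succ n]
          group

theorem mul_pow_mem_of_commutator_mem {W : Subgroup G} (hW : W.Normal) {g h : G}
    (hgh : ⁅g, h⁆ ∈ W) (n : ℕ) : (g ^ n * h ^ n)⁻¹ * (g * h) ^ n ∈ W := by
  rw [← QuotientGroup.eq]
  have : Commute (g : G ⧸ W) (h : G ⧸ W) := by
    rw [← commutatorElement_eq_one_iff_commute]
    have := map_commutatorElement (QuotientGroup.mk' W) g h
    rw [QuotientGroup.mk'_apply, (QuotientGroup.eq_one_iff _).2 hgh] at this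
    exact this.symm
  simp [this.mul_pow]

end PowerSubgroup

/-! ### Powerful embedding modulo a normal subgroup, and iterated power subgroups -/

section Embedded

variable {G : Type*} [Group G] {p : ℕ}

/-- With `c = ⁅g, n⁆` and `e = ⁅n, c⁆` central, `g n^p g⁻¹ = (c n)^p = e^C(p,2) c^p n^p`. Both `c`
and `e` have `p`-th power `1`, and `p ∣ C(p,2)` because `p` is odd. -/
theorem pow_mem_center_of_central_commutator (hp : p.Prime) (hp2 : p ≠ 2) {N M : Subgroup G}
    (hMn : M.Normal)
    (hN : ∀ n ∈ N, ∀ g : G, ⁅g, n⁆ ∈ powerSubgroup p N ⊔ M) (hM : M ≤ Subgroup.center G)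
    (hMp : ∀ m ∈ M, m ^ p = 1) (hNp : ∀ a ∈ powerSubgroup p N, a ^ p = 1)
    (hc : ∀ a ∈ powerSubgroup p N, ∀ g : G, ⁅g, a⁆ ∈ Subgroup.center G) {n : G} (hn : n ∈ N) :
    n ^ p ∈ Subgroup.center G := by
  rw [Subgroup.mem_center_iff]
  intro g
  set c := ⁅g, n⁆ with hcdef
  obtain ⟨a, ha, m, hm, ham⟩ := Subgroup.mem_sup_of_normal_right.1 (hN n hn g)
  have hcm : ∀ x, x * m = m * x := Subgroup.mem_center_iff.1 (hM hm)
  have hcp : c ^ p = 1 := by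
    rw [hcdef, ← ham, (show Commute a m from hcm a).mul_pow, hNp a ha, hMp m hm, one_mul]
  have he : ⁅n, c⁆ ∈ Subgroup.center G := by
    have : ⁅n, c⁆ = ⁅n, a⁆ := by
      have h1 : ⁅n, m⁆ = 1 := commutatorElement_eq_one_iff_mul_comm.2 (hcm n)
      have h2 : ⁅n, a * m⁆ = ⁅n, a⁆ * (a * ⁅n, m⁆ * a⁻¹) := by
        simp only [commutatorElement_def]; group
      rw [hcdef, ← ham, h2, h1]; simp
    rw [this]
    exact hc a ha n
  have hep : ⁅n, c⁆ ^ p = 1 := by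
    set e := ⁅n, c⁆ with hedef
    have h1 : n * c * n⁻¹ = e * c := by rw [hedef, commutatorElement_def]; group
    have h2 : (n * c * n⁻¹) ^ p = 1 := by rw [conj_pow, hcp]; simp
    rwa [h1, (show Commute e c from (Subgroup.mem_center_iff.1 he c).symm).mul_pow, hcp,
      mul_one] at h2
  have hch : ⁅n, c⁆ ^ p.choose 2 = 1 := by
    obtain ⟨q, hq⟩ := hp.dvd_choose_self two_ne_zero (lt_of_le_of_ne hp.two_le (Ne.symm hp2))
    rw [hq, pow_mul, hep, one_pow]
  have h1 : g * n * g⁻¹ = c * n := by rw [hcdef, commutatorElement_def]; group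
  have h2 : g * n ^ p * g⁻¹ = n ^ p := by
    rw [← conj_pow, h1, mul_pow_of_commutator_central he, hch, hcp, one_mul, one_mul]
  exact mul_inv_eq_iff_eq_mul.1 h2

/-- Passing to `p`-th powers in a relative version of powerful embedding. -/
theorem commutator_powerSubgroup_le [Group.IsNilpotent G] (hp : p.Prime) (hp2 : p ≠ 2)
    {N M L : Subgroup G} (hN : N.Normal) (hM : M.Normal) (hL : L.Normal)
    (hNM : ⁅N, (⊤ : Subgroup G)⁆ ≤ powerSubgroup p N ⊔ M)
    (hML : ⁅M, (⊤ : Subgroup G)⁆ ≤ powerSubgroup p M ⊔ L) :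
    ⁅powerSubgroup p N, (⊤ : Subgroup G)⁆ ≤
      powerSubgroup p (powerSubgroup p N) ⊔ powerSubgroup p M ⊔ L := by
  have hNp := powerSubgroup_normal p hN
  have hNpp := powerSubgroup_normal p hNp
  have hMp := powerSubgroup_normal p hM
  set X := ⁅powerSubgroup p N, (⊤ : Subgroup G)⁆ with hX
  set Y := powerSubgroup p (powerSubgroup p N) ⊔ powerSubgroup p M ⊔ L with hY
  refine le_of_le_sup_commutator inferInstance ?_
  -- Modulo `W`, the commutators of `N^p` with `G` are central, `M` is central, and `M` and `N^p`
  -- have trivial `p`-th powers.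
  set W := Y ⊔ ⁅X, (⊤ : Subgroup G)⁆ with hW
  let π := QuotientGroup.mk' W
  have hπ : Function.Surjective π := QuotientGroup.mk'_surjective W
  have hker : ∀ x, π x = 1 ↔ x ∈ W := QuotientGroup.eq_one_iff
  have hmap : ∀ A : Subgroup G, powerSubgroup p (A.map π) = (powerSubgroup p A).map π :=
    fun A => (map_powerSubgroup π p A).symm
  have hcenter : ∀ {x : G}, (∀ g, ⁅x, g⁆ ∈ W) → π x ∈ Subgroup.center (G ⧸ W) := fun {x} h => by
    rw [Subgroup.mem_center_iff]
    intro g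
    obtain ⟨g, rfl⟩ := hπ g
    refine (commutatorElement_eq_one_iff_mul_comm.1 ?_).symm
    rw [← map_commutatorElement, hker]
    exact h g
  have hYW : Y ≤ W := le_sup_left
  have hMpY : powerSubgroup p M ≤ Y := le_sup_right.trans le_sup_left
  have hNpY : powerSubgroup p (powerSubgroup p N) ≤ Y := le_sup_left.trans le_sup_left
  have key : ∀ n ∈ N, π n ^ p ∈ Subgroup.center (G ⧸ W) := by
    intro n hn
    refine pow_mem_center_of_central_commutator hp hp2 (N := N.map π) (M := M.map π)
      (hM.map π hπ) ?_ ?_ ?_ ?_ ?_ ⟨n, hn, rfl⟩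
    · rintro _ ⟨n, hn, rfl⟩ g
      obtain ⟨g, rfl⟩ := hπ g
      rw [hmap, ← Subgroup.map_sup, ← map_commutatorElement]
      refine Subgroup.mem_map_of_mem π (hNM ?_)
      rw [Subgroup.commutator_comm]
      exact Subgroup.commutator_mem_commutator (Subgroup.mem_top g) hn
    · rintro _ ⟨m, hm, rfl⟩
      refine hcenter fun g => hYW ?_
      exact (hML.trans (sup_le hMpY le_sup_right))
        (Subgroup.commutator_mem_commutator hm (Subgroup.mem_top g))
    · rintro _ ⟨m, hm, rfl⟩
      rw [← map_pow, hker]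
      exact hYW (hMpY (pow_mem_powerSubgroup hm))
    · rw [hmap]
      rintro _ ⟨a, ha, rfl⟩
      rw [← map_pow, hker]
      exact hYW (hNpY (pow_mem_powerSubgroup ha))
    · rw [hmap]
      rintro _ ⟨a, ha, rfl⟩ g
      obtain ⟨g, rfl⟩ := hπ g
      rw [← map_commutatorElement]
      refine hcenter fun g' => ?_
      refine (le_sup_right : ⁅X, (⊤ : Subgroup G)⁆ ≤ W)
        (Subgroup.commutator_mem_commutator ?_ (Subgroup.mem_top g'))
      rw [hX, Subgroup.commutator_comm]
      exact Subgroup.commutator_mem_commutator (Subgroup.mem_top g) ha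
  rw [hX]
  refine commutator_closure_le inferInstance ?_
  rintro _ ⟨n, hn, rfl⟩ g -
  rw [← hker, map_commutatorElement, commutatorElement_eq_one_iff_mul_comm]
  have := Subgroup.mem_center_iff.1 (key n hn) (π g)
  simpa using this.symm

/-- A chain whose factors are powerfully embedded yields a powerfully embedded subgroup with
nilpotent quotient. -/
theorem exists_powerfullyEmbedded_of_chain [Group.IsNilpotent G] (hp : p.Prime) (hp2 : p ≠ 2)
    {Q : ℕ → Subgroup G} (hn : ∀ j, (Q j).Normal) {k : ℕ} (h0 : Q 0 = ⊥) (hk : Q k = ⊤)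
    (hQ : ∀ j, ⁅Q (j + 1), (⊤ : Subgroup G)⁆ ≤ powerSubgroup p (Q (j + 1)) ⊔ Q j) :
    ∃ P : Subgroup G, P.Normal ∧ ⁅P, (⊤ : Subgroup G)⁆ ≤ powerSubgroup p P ∧
      (⊤ : Subgroup G).lowerCentralSeries k ≤ powerSubgroup p P := by
  rcases Nat.eq_zero_or_pos k with rfl | hkpos
  · have h : (⊤ : Subgroup G) = ⊥ := hk.symm.trans h0
    exact ⟨⊥, inferInstance, by simp, by simp [h]⟩
  -- The witnesses are `P_0 = G` and `P_{i+1} = P_i^p Q_{k-1-i}`; at `i = k - 1` the error term is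
  -- `Q 0 = 1`.
  have key : ∀ i < k, ∃ P : Subgroup G, P.Normal ∧
      ⁅P, (⊤ : Subgroup G)⁆ ≤ powerSubgroup p P ⊔ Q (k - 1 - i) ∧
      (⊤ : Subgroup G).lowerCentralSeries i ≤ P := by
    intro i hi
    induction i with
    | zero =>
      refine ⟨⊤, inferInstance, ?_, le_top⟩
      have := hQ (k - 1)
      rwa [Nat.sub_add_cancel hkpos, hk] at this
    | succ i ih =>
      obtain ⟨P, hPn, hP, hlcs⟩ := ih (by omega)
      obtain ⟨j, hj⟩ : ∃ j, k - 1 - i = j + 1 := ⟨k - 1 - i - 1, by omega⟩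
      rw [hj] at hP
      rw [show k - 1 - (i + 1) = j by omega]
      have := powerSubgroup_normal p hPn
      have := hn j
      have := hn (j + 1)
      have hn' : (powerSubgroup p P ⊔ Q (j + 1)).Normal := inferInstance
      have := powerSubgroup_normal p hn'
      refine ⟨powerSubgroup p P ⊔ Q (j + 1), hn', ?_,
        (Subgroup.commutator_mono hlcs le_rfl).trans hP⟩
      have hQle : powerSubgroup p (Q (j + 1)) ⊔ Q j ≤
          powerSubgroup p (powerSubgroup p P ⊔ Q (j + 1)) ⊔ Q j :=
        sup_le_sup_right (powerSubgroup_mono p le_sup_right) _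
      refine commutator_sup_le inferInstance
        ((commutator_powerSubgroup_le hp hp2 hPn (hn (j + 1)) (hn j) hP (hQ j)).trans ?_)
        ((hQ j).trans hQle)
      rw [sup_assoc]
      exact sup_le ((powerSubgroup_mono p le_sup_left).trans le_sup_left) hQle
  obtain ⟨P, hPn, hP, hlcs⟩ := key (k - 1) (by omega)
  rw [Nat.sub_self, h0, sup_bot_eq] at hP
  refine ⟨P, hPn, hP, ?_⟩
  rw [← Nat.sub_add_cancel hkpos]
  exact (Subgroup.commutator_mono hlcs le_rfl).trans hP

/-- A nontrivial finite `p`-group has a normal subgroup of index `p`, which contains all `p`-th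
powers. -/
theorem powerSubgroup_lt_self [Finite G] (hp : p.Prime) (hG : IsPGroup p G) {A : Subgroup G}
    (hA : A ≠ ⊥) : powerSubgroup p A < A := by
  have := Fact.mk hp
  refine lt_of_le_of_ne (powerSubgroup_le_self p A) fun heq => ?_
  obtain ⟨n, hn⟩ := IsPGroup.iff_card.1 (hG.to_subgroup A)
  obtain ⟨m, rfl⟩ : ∃ m, n = m + 1 := by
    cases n with
    | zero => exact absurd (Subgroup.card_eq_one.1 (by simpa using hn)) hA
    | succ m => exact ⟨m, rfl⟩
  obtain ⟨H, hH⟩ := Sylow.exists_subgroup_card_pow_prime p (G := A) (n := m)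
    (hn ▸ pow_dvd_pow p (Nat.le_succ m))
  have hidx : H.index = p := by
    have h1 := H.card_mul_index
    rw [hH, hn, pow_succ] at h1
    exact Nat.eq_of_mul_eq_mul_left (pow_pos hp.pos m) h1
  have hnormal : H.Normal := Subgroup.normal_of_index_eq_minFac_card (by
    rw [hidx, hn, hp.pow_minFac (Nat.succ_ne_zero m)])
  have h2 : powerSubgroup p A ≤ H.map A.subtype := powerSubgroup_le_iff.2 fun x hx =>
    ⟨⟨x, hx⟩ ^ p, by simpa [hidx] using H.pow_index_mem (⟨x, hx⟩ : A), rfl⟩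
  rw [heq] at h2
  have h3 : H = ⊤ := by
    rw [eq_top_iff]
    rintro ⟨x, hx⟩ -
    obtain ⟨y, hy, hyx⟩ := h2 hx
    rwa [show (⟨x, hx⟩ : A) = y from Subtype.ext hyx.symm]
  rw [h3, Subgroup.index_top] at hidx
  exact hp.one_lt.ne hidx

/-- The iterated power subgroups of `N`. -/
def powerSeries (p : ℕ) (N : Subgroup G) : ℕ → Subgroup G
  | 0 => N
  | a + 1 => powerSubgroup p (powerSeries p N a)

variable {N : Subgroup G}

theorem powerSeries_antitone (p : ℕ) (N : Subgroup G) : Antitone (powerSeries p N) :=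
  antitone_nat_of_succ_le fun _ => powerSubgroup_le_self _ _

theorem powerSeries_normal (hN : N.Normal) (a : ℕ) : (powerSeries p N a).Normal := by
  induction a with
  | zero => exact hN
  | succ a ih => exact powerSubgroup_normal p ih

theorem exists_powerSeries_eq_bot [Finite G] (hp : p.Prime) (hG : IsPGroup p G)
    (N : Subgroup G) : ∃ a, powerSeries p N a = ⊥ := by
  by_contra! h
  exact not_strictAnti_of_wellFoundedLT (powerSeries p N)
    (strictAnti_nat_of_succ_lt fun a => powerSubgroup_lt_self hp hG (h a))

theorem commutator_powerSeries_top_le [Group.IsNilpotent G] (hp : p.Prime) (hp2 : p ≠ 2)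
    (hN : N.Normal) (h : ⁅N, (⊤ : Subgroup G)⁆ ≤ powerSubgroup p N) (a : ℕ) :
    ⁅powerSeries p N a, (⊤ : Subgroup G)⁆ ≤ powerSeries p N (a + 1) := by
  induction a with
  | zero => exact h
  | succ a ih =>
    have hb : powerSubgroup p (⊥ : Subgroup G) = ⊥ := le_bot_iff.1 (powerSubgroup_le_self p ⊥)
    have := commutator_powerSubgroup_le hp hp2 (powerSeries_normal hN a)
      (M := ⊥) (L := ⊥) inferInstance inferInstance (by rw [sup_bot_eq]; exact ih) (by simp)
    rw [hb, sup_bot_eq, sup_bot_eq] at this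
    exact this

/-- Induction on `b`: in `x = ⁅x, y⁆ · y x y⁻¹` the factors commute modulo the target, so `⁅x^p, y⁆`
agrees there with `⁅x, y⁆^p`, which is a `p`-th power from one term earlier. -/
theorem commutator_powerSeries_le [Group.IsNilpotent G] (hp : p.Prime) (hp2 : p ≠ 2)
    (hN : N.Normal) (h : ⁅N, (⊤ : Subgroup G)⁆ ≤ powerSubgroup p N) (a b : ℕ) :
    ⁅powerSeries p N a, powerSeries p N b⁆ ≤ powerSeries p N (a + b + 1) := by
  induction b with
  | zero =>
    exact (Subgroup.commutator_mono le_rfl le_top).trans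
      (commutator_powerSeries_top_le hp hp2 hN h a)
  | succ b ih =>
    have hW := powerSeries_normal (p := p) hN (a + b + 1 + 1)
    rw [Subgroup.commutator_comm] at ih ⊢
    refine commutator_closure_le hW ?_
    rintro _ ⟨x, hx, rfl⟩ y hy
    have hxy : ⁅x, y⁆ ∈ powerSeries p N (a + b + 1) :=
      ih (Subgroup.commutator_mem_commutator hx hy)
    have hcomm' : ⁅⁅x, y⁆, y * x * y⁻¹⁆ ∈ powerSeries p N (a + b + 1 + 1) :=
      commutator_powerSeries_top_le hp hp2 hN h (a + b + 1)
        (Subgroup.commutator_mem_commutator hxy (Subgroup.mem_top _))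
    have h1 := mul_pow_mem_of_commutator_mem hW hcomm' p
    have h2 : ⁅x, y⁆ * (y * x * y⁻¹) = x := by rw [commutatorElement_def]; group
    rw [h2, conj_pow] at h1
    have h3 : ⁅x, y⁆ ^ p ∈ powerSeries p N (a + b + 1 + 1) := pow_mem_powerSubgroup hxy
    have h4 : ⁅x ^ p, y⁆ = ⁅x, y⁆ ^ p * ((y * x ^ p * y⁻¹) *
        ((⁅x, y⁆ ^ p * (y * x ^ p * y⁻¹))⁻¹ * x ^ p) * (y * x ^ p * y⁻¹)⁻¹) := by
      generalize ⁅x, y⁆ ^ p = c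
      rw [commutatorElement_def]; group
    change ⁅x ^ p, y⁆ ∈ _
    rw [h4]
    exact mul_mem h3 (hW.conj_mem _ h1 _)

/-- Successive approximation: taking `p`-th powers is multiplicative modulo the next term, and the
errors move down a series that reaches `1`. The bound `1 ≤ a` gives `a + 2 ≤ 2a + 1`, so commutators
fall into the error term. -/
theorem exists_pow_of_mem_powerSeries_succ [Group.IsNilpotent G] (hp : p.Prime) (hp2 : p ≠ 2)
    (hN : N.Normal) (h : ⁅N, (⊤ : Subgroup G)⁆ ≤ powerSubgroup p N) {a : ℕ} (ha : 1 ≤ a)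
    (hbot : ∃ c, powerSeries p N c = ⊥) {u : G} (hu : u ∈ powerSeries p N (a + 1)) :
    ∃ x ∈ powerSeries p N a, x ^ p = u := by
  have hc := commutator_powerSeries_le hp hp2 hN h
  have hanti := powerSeries_antitone p N
  have hnorm := powerSeries_normal (p := p) hN
  have step : ∀ b, 1 ≤ b → ∀ v ∈ powerSeries p N (b + 1), ∃ x ∈ powerSeries p N b,
      (x ^ p)⁻¹ * v ∈ powerSeries p N (b + 2) := by
    intro b hb v hv
    have hW := hnorm (b + 2)
    induction hv using Subgroup.closure_induction with
    | mem v hv =>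
      obtain ⟨x, hx, rfl⟩ := hv
      exact ⟨x, hx, by simp⟩
    | one => exact ⟨1, one_mem _, by simp⟩
    | mul v w _ _ hv hw =>
      obtain ⟨x, hx, hxv⟩ := hv
      obtain ⟨y, hy, hyw⟩ := hw
      refine ⟨x * y, mul_mem hx hy, ?_⟩
      have h1 := mul_pow_mem_of_commutator_mem hW (hanti (by omega : b + 2 ≤ b + b + 1)
        (hc b b (Subgroup.commutator_mem_commutator hx hy))) p
      rw [← QuotientGroup.eq] at h1 hxv hyw ⊢
      rw [← h1, QuotientGroup.mk_mul, QuotientGroup.mk_mul, hxv, hyw]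
    | inv v _ hv =>
      obtain ⟨x, hx, hxv⟩ := hv
      refine ⟨x⁻¹, inv_mem hx, ?_⟩
      rw [← QuotientGroup.eq] at hxv ⊢
      rw [inv_pow, QuotientGroup.mk_inv, QuotientGroup.mk_inv, hxv]
  have key : ∀ r, ∃ x ∈ powerSeries p N a, (x ^ p)⁻¹ * u ∈ powerSeries p N (a + 1 + r) := by
    intro r
    induction r with
    | zero => exact ⟨1, one_mem _, by simpa using hu⟩
    | succ r ih =>
      obtain ⟨x, hx, hxu⟩ := ih
      have hW := hnorm (a + r + 2)
      obtain ⟨y, hy, hyv⟩ := step (a + r) (by omega) _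
        (by rwa [show a + r + 1 = a + 1 + r by omega])
      refine ⟨x * y, mul_mem hx (hanti (by omega) hy), ?_⟩
      have h1 := mul_pow_mem_of_commutator_mem hW
        (hanti (by omega : a + r + 2 ≤ a + (a + r) + 1)
          (hc a (a + r) (Subgroup.commutator_mem_commutator hx hy))) p
      rw [show a + 1 + (r + 1) = a + r + 2 by omega]
      rw [← QuotientGroup.eq] at h1 hyv ⊢
      rw [← h1, QuotientGroup.mk_mul, hyv, QuotientGroup.mk_mul, QuotientGroup.mk_inv]
      simp
  obtain ⟨c, hcb⟩ := hbot
  obtain ⟨x, hx, hxu⟩ := key c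
  refine ⟨x, hx, ?_⟩
  have := hanti (by omega : c ≤ a + 1 + c) hxu
  rw [hcb, Subgroup.mem_bot] at this
  exact inv_mul_eq_one.1 this

end Embedded

/-! ### Commutators and torsion in power filtrations -/

/-! ### Divisibility of binomial coefficients by powers of `p` -/

section Binomial

/-- The `p`-adic valuation of the binomial coefficients of a power of `p`. -/
theorem exists_pow_sub_dvd_choose {p : ℕ} (hp : p.Prime) (N n : ℕ) :
    ∃ v, (p - 1) * v ≤ n ∧ p ^ (N - v) ∣ (p ^ N).choose (n + 1) := by
  obtain ⟨v, m, hm, hvm⟩ := Nat.exists_eq_pow_mul_and_not_dvd (Nat.succ_ne_zero n) p hp.ne_one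
  refine ⟨v, ?_, ?_⟩
  · have h1 : 1 + v * (p - 1) ≤ p ^ v := by
      obtain ⟨q, rfl⟩ : ∃ q, p = q + 1 := ⟨p - 1, (Nat.sub_add_cancel hp.one_le).symm⟩
      rw [Nat.add_sub_cancel]
      clear hvm
      induction v with
      | zero => simp
      | succ v ih =>
        rw [pow_succ]
        refine le_trans ?_ (Nat.mul_le_mul_right (q + 1) ih)
        nlinarith [Nat.zero_le (v * q * q)]
    have hmpos : 0 < m := Nat.pos_of_ne_zero fun h => hm (h ▸ dvd_zero p)
    have h2 : p ^ v ≤ n + 1 := (Nat.le_mul_of_pos_right _ hmpos).trans_eq hvm.symm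
    rw [mul_comm]; omega
  · rcases le_or_gt N v with h | h
    · simp [Nat.sub_eq_zero_of_le h]
    -- Compare powers of `p` in `(n+1) C(p^N, n+1) = p^N C(p^N - 1, n)`, where `n + 1 = p^v m` with
    -- `p ∤ m`.
    have h1 := Nat.add_one_mul_choose_eq (p ^ N - 1) n
    have hpos : 0 < p ^ N := pow_pos hp.pos N
    rw [Nat.sub_add_cancel hpos] at h1
    generalize (p ^ N).choose (n + 1) = C at h1 ⊢
    rw [← Nat.succ_eq_add_one n, hvm] at h1
    have h2 : p ^ v * p ^ (N - v) ∣ p ^ v * (C * m) := by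
      rw [← pow_add, Nat.add_sub_cancel' h.le, ← mul_assoc, mul_comm (p ^ v), mul_assoc, ← h1]
      exact dvd_mul_right _ _
    have h3 := Nat.dvd_of_mul_dvd_mul_left (pow_pos hp.pos v) h2
    exact (Nat.Coprime.pow_left _ ((Nat.Prime.coprime_iff_not_dvd hp).2 hm)).dvd_of_dvd_mul_right h3

/-- For odd `p`, `2v ≤ (p-1)v ≤ n`, hence `v ≤ n - 1` once `n ≥ 1`. -/
theorem pow_dvd_choose {p : ℕ} (hp : p.Prime) (hp2 : p ≠ 2) (N : ℕ) {n : ℕ} (hn : 1 ≤ n) :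
    p ^ (N + 1 - n) ∣ (p ^ N).choose (n + 1) := by
  obtain ⟨v, hv, hdvd⟩ := exists_pow_sub_dvd_choose hp N n
  have h2 : 2 ≤ p - 1 := by
    have := hp.two_le
    omega
  have h3 : 2 * v ≤ n := (Nat.mul_le_mul_right v h2).trans hv
  exact (pow_dvd_pow p (by omega)).trans hdvd

theorem pow_eq_one_of_dvd {G : Type*} [Monoid G] {g : G} {m n : ℕ} (h : g ^ m = 1) (hmn : m ∣ n) :
    g ^ n = 1 := by
  obtain ⟨k, rfl⟩ := hmn
  rw [pow_mul, h, one_pow]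

theorem pow_prime_pow_eq_one_of_le {G : Type*} [Monoid G] {p : ℕ} {g : G} {m n : ℕ}
    (h : g ^ p ^ m = 1) (hmn : m ≤ n) : g ^ p ^ n = 1 :=
  pow_eq_one_of_dvd h (pow_dvd_pow p hmn)

end Binomial

section LowerCentralSeries

variable {G : Type*} [Group G]

/-- A descending series of normal subgroups bounds the lower central series of a subgroup as soon as
it does so on generators. -/
theorem lowerCentralSeries_closure_le {S : Set G} {F : ℕ → Subgroup G} (hF : ∀ n, (F n).Normal)
    (h1 : ∀ s ∈ S, ∀ t ∈ S, ⁅s, t⁆ ∈ F 1)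
    (hstep : ∀ n, 1 ≤ n → ∀ u ∈ F n, ∀ s ∈ S, ⁅u, s⁆ ∈ F (n + 1)) {n : ℕ} (hn : 1 ≤ n) :
    (Subgroup.closure S).lowerCentralSeries n ≤ F n := by
  induction n, hn using Nat.le_induction with
  | base =>
    refine commutator_closure_le (hF 1) fun s hs t ht => ?_
    rw [← commutatorElement_inv]
    exact inv_mem (commutatorElement_mem_of_mem_closure (hF 1) (fun t ht => h1 t ht s hs) ht)
  | succ n hn ih =>
    refine (Subgroup.commutator_mono ih le_rfl).trans ?_
    rw [Subgroup.commutator_comm]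
    refine commutator_closure_le (hF _) fun s hs u hu => ?_
    rw [← commutatorElement_inv]
    exact inv_mem (hstep n hn u hu s hs)

end LowerCentralSeries

/-! ### Torsion in power filtrations -/

section Filtration

variable {G : Type*} [Group G]

/-- The subgroup generated by the elements of `A` killed by `n`. -/
def torsionClosure (A : Subgroup G) (n : ℕ) : Subgroup G :=
  Subgroup.closure {x | x ∈ A ∧ x ^ n = 1}

theorem mem_torsionClosure {A : Subgroup G} {n : ℕ} {x : G} (hx : x ∈ A) (h : x ^ n = 1) :
    x ∈ torsionClosure A n :=
  Subgroup.subset_closure ⟨hx, h⟩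

theorem torsionClosure_le (A : Subgroup G) (n : ℕ) : torsionClosure A n ≤ A :=
  (Subgroup.closure_le _).2 fun _ hx => hx.1

theorem closure_normal_of_conj {S : Set G} (hS : ∀ x ∈ S, ∀ g, g * x * g⁻¹ ∈ S) :
    (Subgroup.closure S).Normal := by
  constructor
  intro x hx g
  have h : (Subgroup.closure S).map (MulAut.conj g).toMonoidHom ≤ Subgroup.closure S := by
    rw [MonoidHom.map_closure]
    refine Subgroup.closure_mono ?_
    rintro _ ⟨y, hy, rfl⟩
    exact hS y hy g
  exact h ⟨x, hx, rfl⟩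

theorem torsionClosure_normal {A : Subgroup G} (hA : A.Normal) (n : ℕ) :
    (torsionClosure A n).Normal :=
  closure_normal_of_conj fun x hx g =>
    ⟨hA.conj_mem x hx.1 g, by rw [conj_pow, hx.2]; simp⟩

/-- A filtration of a `p`-group in which commutators add degrees, and in which the terms of degree at
least two consist of `p`-th powers from the preceding one. -/
structure IsPowerFiltration (p : ℕ) (J : ℕ → Subgroup G) (B : ℕ) : Prop where
  normal : ∀ a, (J a).Normal
  antitone : Antitone J
  commutator_le : ∀ a b, 2 ≤ a → 1 ≤ b → ⁅J a, J b⁆ ≤ J (a + b)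
  exists_pow : ∀ a, 2 ≤ a → ∀ u ∈ J (a + 1), ∃ x ∈ J a, x ^ p = u
  eq_bot : J B = ⊥
  isPGroup : IsPGroup p G

/-- The elements of `J r` killed by a given power of `p` form a subgroup. -/
def TorsionClosed (p : ℕ) (J : ℕ → Subgroup G) (r : ℕ) : Prop :=
  ∀ j, ∀ x ∈ torsionClosure (J r) (p ^ j), x ^ p ^ j = 1

/-- Commutators of `J b` with elements of `J c` killed by a power of `p` are killed by the same
power of `p`. -/
def CommutatorTorsion (p : ℕ) (J : ℕ → Subgroup G) (b c : ℕ) : Prop :=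
  ∀ i, ∀ x ∈ J b, ∀ y ∈ J c, y ^ p ^ i = 1 → ⁅x, y⁆ ^ p ^ i = 1

/-- Commutators of torsion elements of `J (b + n)` with elements of `J c`. -/
def CommutatorTorsionDrop (p : ℕ) (J : ℕ → Subgroup G) (b c : ℕ) : Prop :=
  ∀ i n, ∀ u ∈ J (b + n), ∀ y ∈ J c, u ^ p ^ (i + 1 - n) = 1 → y ^ p ^ i = 1 →
    ⁅u, y⁆ ^ p ^ (i - n) = 1

variable {p : ℕ} {J : ℕ → Subgroup G} {B : ℕ}

theorem IsPowerFiltration.exists_prime_pow (hJ : IsPowerFiltration p J B) {b : ℕ} (hb : 2 ≤ b)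
    (n : ℕ) {u : G} (hu : u ∈ J (b + n)) : ∃ x ∈ J b, x ^ p ^ n = u := by
  induction n generalizing u with
  | zero => exact ⟨u, hu, by simp⟩
  | succ n ih =>
    obtain ⟨v, hv, rfl⟩ := hJ.exists_pow (b + n) (by omega) u hu
    obtain ⟨x, hx, rfl⟩ := ih hv
    exact ⟨x, hx, by rw [pow_succ, pow_mul]⟩

theorem IsPowerFiltration.commutator_mem (hJ : IsPowerFiltration p J B) {a b c : ℕ} (ha : 2 ≤ a)
    (hb : 1 ≤ b) (hc : c ≤ a + b) {x y : G} (hx : x ∈ J a) (hy : y ∈ J b) : ⁅x, y⁆ ∈ J c :=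
  hJ.antitone hc (hJ.commutator_le a b ha hb (Subgroup.commutator_mem_commutator hx hy))

/-- The hypotheses put `γ_{n+1}` of the torsion closure inside the `p^(j+1-n)`-torsion closure of `J
(r+n)`, of that exponent by downward induction on `r`. Since `p^(j+1-n) ∣ C(p^j, n+1)`, the `p^j`-th
power is multiplicative. -/
theorem IsPowerFiltration.torsionClosed (hJ : IsPowerFiltration p J B) (hp : p.Prime) (hp2 : p ≠ 2)
    (d : ℕ) {r : ℕ} (hr : 2 ≤ r) (hd : B ≤ r + d)
    (h0 : ∀ s, r ≤ s → CommutatorTorsion p J s s)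
    (h1 : ∀ s, r ≤ s → CommutatorTorsionDrop p J s s) : TorsionClosed p J r := by
  induction d generalizing r with
  | zero =>
    intro j x hx
    have := hJ.antitone hd (torsionClosure_le _ _ hx)
    rw [hJ.eq_bot, Subgroup.mem_bot] at this
    rw [this, one_pow]
  | succ d ih =>
    intro j
    have hT : ∀ n, 1 ≤ n → TorsionClosed p J (r + n) := fun n hn =>
      ih (by omega) (by omega) (fun s hs => h0 s (by omega)) (fun s hs => h1 s (by omega))
    have hF : ∀ n, 1 ≤ n → (torsionClosure (J r) (p ^ j)).lowerCentralSeries n ≤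
        torsionClosure (J (r + n)) (p ^ (j + 1 - n)) := fun n hn =>
      lowerCentralSeries_closure_le
        (F := fun n => torsionClosure (J (r + n)) (p ^ (j + 1 - n)))
        (fun n => torsionClosure_normal (hJ.normal _) _)
        (fun s hs t ht => mem_torsionClosure
          (hJ.commutator_mem hr (by omega) (by omega) hs.1 ht.1)
          (h0 r le_rfl j s hs.1 t ht.1 ht.2))
        (fun n hn u hu s hs => by
          have hu' := torsionClosure_le _ _ hu
          refine mem_torsionClosure
            (hJ.commutator_mem (by omega) (by omega : 1 ≤ r) (by omega) hu' hs.1) ?_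
          rw [Nat.add_sub_add_right]
          exact h1 r le_rfl j n u hu' s hs.1 (hT n hn _ u hu) hs.2) hn
    intro x hx
    induction hx using Subgroup.closure_induction with
    | mem x hx => exact hx.2
    | one => exact one_pow _
    | mul x y hx hy ihx ihy =>
      rw [mul_pow_of_hallPetrescu (T := torsionClosure (J r) (p ^ j)) ?_ hx hy, ihx, ihy, one_mul]
      intro n hn g hg
      exact pow_eq_one_of_dvd (hT n hn _ g (hF n hn hg)) (pow_dvd_choose hp hp2 j hn)
    | inv x _ ihx => rw [inv_pow, ihx, inv_one]

/-- With `z = ⁅x, y⁆`, the product `zy` is conjugate to `y`. If the `p^j`-th power is multiplicative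
on `⟨y, z⟩` and kills `y`, it kills `z`. The order of `z` is lowered from `p^(j+1)` to `p^j` until
`p^i` is reached. -/
theorem IsPowerFiltration.commutatorTorsion_step (hJ : IsPowerFiltration p J B) (hp : p.Prime)
    (hp2 : p ≠ 2) {b c : ℕ} (hb : 2 ≤ b) (hc : 1 ≤ c)
    (hT : ∀ r, b + c ≤ r → TorsionClosed p J r)
    (h0 : CommutatorTorsion p J (b + c) c)
    (h1 : CommutatorTorsionDrop p J (b + c) c)
    (h2 : CommutatorTorsionDrop p J (b + c - 1) (b + c)) : CommutatorTorsion p J b c := by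
  intro i x hx y hy hyi
  set z := ⁅x, y⁆ with hz
  have hzJ : z ∈ J (b + c) := hJ.commutator_mem hb hc le_rfl hx hy
  have step : ∀ m, z ^ p ^ (i + m) = 1 → z ^ p ^ i = 1 := by
    intro m
    induction m with
    | zero => exact id
    | succ m ih =>
      intro hzm
      apply ih
      set j := i + m with hj
      have hyj : y ^ p ^ j = 1 := pow_prime_pow_eq_one_of_le hyi (by omega)
      have hF : ∀ n, 1 ≤ n → (Subgroup.closure {y, z}).lowerCentralSeries n ≤
          torsionClosure (J (b + c + n)) (p ^ (j + 1 - n)) := fun n hn => by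
        have hzy : ⁅z, y⁆ ∈ torsionClosure (J (b + c + 1)) (p ^ (j + 1 - 1)) :=
          mem_torsionClosure (hJ.commutator_mem (by omega) hc (by omega) hzJ hy)
            (h0 j z hzJ y hy hyj)
        refine lowerCentralSeries_closure_le
          (F := fun n => torsionClosure (J (b + c + n)) (p ^ (j + 1 - n)))
          (fun n => torsionClosure_normal (hJ.normal _) _) ?_ ?_ hn
        · rintro s (rfl | rfl) t (rfl | rfl)
          · rw [commutatorElement_self]; exact one_mem _
          · rw [← commutatorElement_inv]; exact inv_mem hzy
          · exact hzy
          · rw [commutatorElement_self]; exact one_mem _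
        · intro n hn u hu s hs
          have hu' := torsionClosure_le _ _ hu
          have hun := hT (b + c + n) (by omega) _ u hu
          simp only [Nat.add_sub_add_right]
          rcases hs with rfl | rfl
          · exact mem_torsionClosure
              (hJ.commutator_mem (by omega) hc (by omega) hu' hy)
              (h1 j n u hu' _ hy hun hyj)
          · refine mem_torsionClosure
              (hJ.commutator_mem (by omega) (by omega : 1 ≤ b + c) (by omega) hu' hzJ) ?_
            -- Only `z ^ p ^ (j + 1) = 1` is known so far. Viewing `u` as lying `n + 1` steps below
            -- `J (b + c - 1)` makes up for the extra factor `p`.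
            have := h2 (j + 1) (n + 1) u (by convert hu' using 2; omega) _ hzJ
              (pow_prime_pow_eq_one_of_le hun (by omega)) hzm
            rwa [Nat.add_sub_add_right] at this
      have hzT : z ∈ Subgroup.closure {y, z} := Subgroup.subset_closure (by simp)
      have hyT : y ∈ Subgroup.closure {y, z} := Subgroup.subset_closure (by simp)
      have hpow := mul_pow_of_hallPetrescu (N := p ^ j) (fun n hn g hg =>
        pow_eq_one_of_dvd (hT _ (by omega) _ g (hF n hn hg)) (pow_dvd_choose hp hp2 j hn)) hzT hyT
      have hconj : z * y = x * y * x⁻¹ := by rw [hz, commutatorElement_def]; group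
      rw [hconj, conj_pow, hyj, mul_one, mul_one, mul_inv_cancel] at hpow
      exact hpow.symm
  obtain ⟨m, hm⟩ := hJ.isPGroup z
  exact step m (pow_prime_pow_eq_one_of_le hm (by omega))

/-- Write `u = x^(p^s)` with `x ∈ J b` and `z = ⁅x, y⁆`. Then `⁅u, y⁆ = x^(p^s) (x⁻¹z)^(p^s)`, and
Hall–Petrescu in `⟨x, z⟩` expresses it by `z^(p^s)` and binomial powers, all killed by `p^(i-s)`. -/
theorem IsPowerFiltration.commutatorTorsionDrop_step (hJ : IsPowerFiltration p J B) (hp : p.Prime)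
    (hp2 : p ≠ 2) {b c : ℕ} (hb : 2 ≤ b) (hc : 1 ≤ c)
    (hT : ∀ r, b + c ≤ r → TorsionClosed p J r)
    (h0 : CommutatorTorsion p J b c)
    (h0' : CommutatorTorsion p J b (b + c))
    (h1 : CommutatorTorsionDrop p J (b + c - 1) b)
    (h2 : CommutatorTorsionDrop p J (b + c) (b + c)) : CommutatorTorsionDrop p J b c := by
  intro i s u hu y hy hus hyi
  rcases lt_or_ge i s with his | his
  · rw [Nat.sub_eq_zero_of_le (by omega : i + 1 ≤ s), pow_zero, pow_one] at hus
    rw [hus, commutatorElement_one_left, one_pow]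
  obtain ⟨x, hx, rfl⟩ := hJ.exists_prime_pow hb s hu
  have hxi : x ^ p ^ (i + 1) = 1 := by
    rw [← pow_mul, ← pow_add, Nat.add_sub_cancel' (by omega)] at hus
    exact hus
  set z := ⁅x, y⁆ with hz
  have hzJ : z ∈ J (b + c) := hJ.commutator_mem hb hc le_rfl hx hy
  have hzi : z ^ p ^ i = 1 := h0 i x hx y hy hyi
  have hF : ∀ n, 1 ≤ n → (Subgroup.closure {x, z}).lowerCentralSeries n ≤
      torsionClosure (J (b + c + n)) (p ^ (i + 1 - n)) := fun n hn => by
    have hxz : ⁅x, z⁆ ∈ torsionClosure (J (b + c + 1)) (p ^ (i + 1 - 1)) :=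
      mem_torsionClosure (hJ.commutator_mem hb (by omega : 1 ≤ b + c) (by omega) hx hzJ)
        (h0' i x hx z hzJ hzi)
    refine lowerCentralSeries_closure_le
      (F := fun n => torsionClosure (J (b + c + n)) (p ^ (i + 1 - n)))
      (fun n => torsionClosure_normal (hJ.normal _) _) ?_ ?_ hn
    · rintro s (rfl | rfl) t (rfl | rfl)
      · rw [commutatorElement_self]; exact one_mem _
      · exact hxz
      · rw [← commutatorElement_inv]; exact inv_mem hxz
      · rw [commutatorElement_self]; exact one_mem _
    · intro n hn u hu s hs
      have hu' := torsionClosure_le _ _ hu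
      have hun := hT (b + c + n) (by omega) _ u hu
      rcases hs with rfl | rfl
      · refine mem_torsionClosure
          (hJ.commutator_mem (by omega) (by omega : 1 ≤ b) (by omega) hu' hx) ?_
        exact h1 (i + 1) (n + 1) u (by convert hu' using 2; omega) _ hx
          (pow_prime_pow_eq_one_of_le hun (by omega)) hxi
      · refine mem_torsionClosure
          (hJ.commutator_mem (by omega) (by omega : 1 ≤ b + c) (by omega) hu' hzJ) ?_
        rw [Nat.add_sub_add_right]
        exact h2 i n u hu' _ hzJ hun hzi
  have hmem := hallPetrescu (T := Subgroup.closure {x, z}) (N := p ^ s)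
    (Q := torsionClosure (J (b + c)) (p ^ (i - s))) (fun n hn g hg => by
      have hg' := hF n hn hg
      refine mem_torsionClosure
        (pow_mem (hJ.antitone (by omega : b + c ≤ b + c + n) (torsionClosure_le _ _ hg')) _) ?_
      rw [← pow_mul]
      refine pow_eq_one_of_dvd (hT _ (by omega) _ g hg')
        ((pow_dvd_pow p (by omega : i + 1 - n ≤ (s + 1 - n) + (i - s))).trans ?_)
      rw [pow_add]
      exact Nat.mul_dvd_mul_right (pow_dvd_choose hp hp2 s hn) _)
    (x := x⁻¹) (z := z) (inv_mem (Subgroup.subset_closure (by simp)))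
    (Subgroup.subset_closure (by simp))
  have hzQ : z ^ p ^ s ∈ torsionClosure (J (b + c)) (p ^ (i - s)) := by
    refine mem_torsionClosure (pow_mem hzJ _) ?_
    rw [← pow_mul, ← pow_add, Nat.add_sub_cancel' his, hzi]
  have hcomm : ⁅x ^ p ^ s, y⁆ = z ^ p ^ s * (z⁻¹ ^ p ^ s * x⁻¹⁻¹ ^ p ^ s * (x⁻¹ * z) ^ p ^ s) := by
    have h1 : x⁻¹ * z = y * x⁻¹ * y⁻¹ := by rw [hz, commutatorElement_def]; group
    rw [h1, conj_pow, inv_inv, inv_pow, inv_pow]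
    generalize x ^ p ^ s = a
    generalize z ^ p ^ s = d
    rw [commutatorElement_def]; group
  rw [hcomm]
  exact hT _ le_rfl _ _ (mul_mem hzQ hmem)

/-- The torsion of commutators in a power filtration. -/
theorem IsPowerFiltration.commutator_torsion (hJ : IsPowerFiltration p J B) (hp : p.Prime)
    (hp2 : p ≠ 2) (d : ℕ) {b c : ℕ} (hb : 2 ≤ b) (hc : 1 ≤ c) (hd : B ≤ b + c + d) :
    CommutatorTorsion p J b c ∧ CommutatorTorsionDrop p J b c := by
  induction d generalizing b c with
  | zero =>
    have hbot : ∀ n, ∀ x ∈ J (b + n), ∀ y ∈ J c, ⁅x, y⁆ = 1 := fun n x hx y hy => by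
      have := hJ.commutator_mem (c := B) (by omega) hc (by omega) hx hy
      rwa [hJ.eq_bot, Subgroup.mem_bot] at this
    refine ⟨fun i x hx y hy _ => ?_, fun i n u hu y hy _ _ => ?_⟩
    · rw [hbot 0 x hx y hy, one_pow]
    · rw [hbot n u hu y hy, one_pow]
  | succ d ih =>
    have hT : ∀ r, b + c ≤ r → TorsionClosed p J r := fun r hr =>
      hJ.torsionClosed hp hp2 B (by omega) (by omega)
        (fun s hs => (ih (by omega) (by omega) (by omega)).1)
        (fun s hs => (ih (by omega) (by omega) (by omega)).2)
    -- Every pair of indices used here and below has sum greater than `b + c`; for `(b + c - 1, b)`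
    -- this needs `b ≥ 2`.
    have h0 := hJ.commutatorTorsion_step hp hp2 hb hc hT
      (ih (by omega) hc (by omega)).1 (ih (by omega) hc (by omega)).2
      (ih (by omega) (by omega) (by omega)).2
    exact ⟨h0, hJ.commutatorTorsionDrop_step hp hp2 hb hc hT h0
      (ih hb (by omega) (by omega)).1 (ih (by omega) (by omega) (by omega)).2
      (ih (by omega) (by omega) (by omega)).2⟩

end Filtration

/-! ### The exponent of the omega subgroups of a finite `p`-group -/

section Exponent

variable {G : Type*} [Group G] {p : ℕ}

/-- The power series of `N`, starting with the whole group. -/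
def powerFiltration (p : ℕ) (N : Subgroup G) (a : ℕ) : Subgroup G :=
  if a ≤ 1 then ⊤ else powerSeries p N (a - 1)

theorem powerFiltration_add_two (p : ℕ) (N : Subgroup G) (a : ℕ) :
    powerFiltration p N (a + 2) = powerSeries p N (a + 1) := by
  rw [powerFiltration, if_neg (by omega)]; rfl

/-- Taking all of `G` in degree `1` is harmless: a commutator with any element of `G` already moves
one step down the power series of `N`. -/
theorem exists_isPowerFiltration [Finite G] (hp : p.Prime) (hp2 : p ≠ 2) (hG : IsPGroup p G)
    {N : Subgroup G} (hN : N.Normal) (h : ⁅N, (⊤ : Subgroup G)⁆ ≤ powerSubgroup p N) :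
    ∃ B, IsPowerFiltration p (powerFiltration p N) B := by
  have := Fact.mk hp
  have : Group.IsNilpotent G := hG.isNilpotent
  obtain ⟨B, hB⟩ := exists_powerSeries_eq_bot hp hG N
  have hanti := powerSeries_antitone p N
  refine ⟨B + 2, ⟨fun a => ?_, fun a b hab => ?_, fun a b ha hb => ?_, fun a ha u hu => ?_, ?_, hG⟩⟩
  · unfold powerFiltration
    split_ifs
    exacts [inferInstance, powerSeries_normal hN _]
  · unfold powerFiltration
    split_ifs
    exacts [le_rfl, by omega, le_top, hanti (by omega)]
  · obtain ⟨a, rfl⟩ : ∃ c, a = c + 2 := ⟨a - 2, by omega⟩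
    rcases hb.eq_or_lt with rfl | hb
    · rw [show a + 2 + 1 = a + 1 + 2 by ring, powerFiltration_add_two, powerFiltration_add_two]
      exact (Subgroup.commutator_mono le_rfl le_top).trans
        (commutator_powerSeries_top_le hp hp2 hN h _)
    · obtain ⟨b, rfl⟩ : ∃ c, b = c + 2 := ⟨b - 2, by omega⟩
      rw [show a + 2 + (b + 2) = a + b + 2 + 2 by ring, powerFiltration_add_two,
        powerFiltration_add_two, powerFiltration_add_two]
      exact (commutator_powerSeries_le hp hp2 hN h _ _).trans (hanti (by omega))
  · obtain ⟨a, rfl⟩ : ∃ c, a = c + 2 := ⟨a - 2, by omega⟩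
    rw [show a + 2 + 1 = a + 1 + 2 by ring, powerFiltration_add_two] at hu
    rw [powerFiltration_add_two]
    exact exists_pow_of_mem_powerSeries_succ hp hp2 hN h (by omega) ⟨B, hB⟩ hu
  · rw [powerFiltration_add_two, eq_bot_iff, ← hB]
    exact hanti (by omega)

theorem lowerCentralSeries_normal {H : Subgroup G} (hH : H.Normal) (n : ℕ) :
    (H.lowerCentralSeries n).Normal := by
  induction n with
  | zero => exact hH
  | succ n ih => exact Subgroup.commutator_normal _ _

theorem lowerCentralSeries_lowerCentralSeries_le (H : Subgroup G) (n m : ℕ) :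
    (H.lowerCentralSeries n).lowerCentralSeries m ≤ H.lowerCentralSeries (n + m) := by
  induction m with
  | zero => exact le_rfl
  | succ m ih => exact Subgroup.commutator_mono ih (Subgroup.lowerCentralSeries_le_self H n)

/-- If `S` is stable under conjugation, then the terms of the lower central series of `⟨S⟩` are
generated by commutators with elements of `S`. -/
theorem lowerCentralSeries_closure_succ_le {S : Set G} (hS : ∀ x ∈ S, ∀ g, g * x * g⁻¹ ∈ S)
    (n : ℕ) : (Subgroup.closure S).lowerCentralSeries (n + 1) ≤
      Subgroup.closure
        {z | ∃ u ∈ (Subgroup.closure S).lowerCentralSeries n, ∃ s ∈ S, ⁅u, s⁆ = z} := by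
  rw [Subgroup.lowerCentralSeries_succ, Subgroup.commutator_comm]
  refine commutator_closure_le (closure_normal_of_conj ?_) fun s hs u hu => ?_
  · rintro _ ⟨u, hu, s, hs, rfl⟩ g
    exact ⟨_, (lowerCentralSeries_normal (closure_normal_of_conj hS) n).conj_mem u hu g, _,
      hS s hs g, (conjugate_commutatorElement u s g).symm⟩
  · rw [← commutatorElement_inv]
    exact inv_mem (Subgroup.subset_closure ⟨u, hu, s, hs, rfl⟩)

/-- Deep terms of the lower central series of an omega subgroup have small exponent. -/
theorem IsPowerFiltration.lowerCentralSeries_le_torsionClosure {J : ℕ → Subgroup G} {B : ℕ}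
    (hJ : IsPowerFiltration p J B) (hp : p.Prime) (hp2 : p ≠ 2) (hJ1 : J 1 = ⊤) {i k : ℕ}
    (hk : (⊤ : Subgroup G).lowerCentralSeries k ≤ J 2) (t : ℕ) :
    (Subgroup.closure {x : G | x ^ p ^ i = 1}).lowerCentralSeries (k + 1 + t) ≤
      torsionClosure (J (3 + t)) (p ^ (i - t)) := by
  have hC := fun b c (hb : 2 ≤ b) (hc : 1 ≤ c) =>
    hJ.commutator_torsion hp hp2 B hb hc (by omega)
  have htop : ∀ y, y ∈ J 1 := fun y => hJ1 ▸ Subgroup.mem_top y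
  have hn : ∀ t, (torsionClosure (J (3 + t)) (p ^ (i - t))).Normal := fun t =>
    torsionClosure_normal (hJ.normal _) _
  induction t with
  | zero =>
    rw [add_zero, Subgroup.lowerCentralSeries_succ, Subgroup.commutator_comm]
    refine commutator_closure_le (hn 0) fun s hs u hu => ?_
    have huJ : u ∈ J 2 := hk (Subgroup.lowerCentralSeries_mono k le_top hu)
    rw [← commutatorElement_inv]
    exact inv_mem (mem_torsionClosure
      (hJ.commutator_mem le_rfl le_rfl le_rfl huJ (htop s))
      ((hC 2 1 le_rfl le_rfl).1 i u huJ s (htop s) hs))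
  | succ t ih =>
    rw [← add_assoc, Subgroup.lowerCentralSeries_succ, Subgroup.commutator_comm]
    refine commutator_closure_le (hn (t + 1)) fun s hs u hu => ?_
    have huJ := torsionClosure_le _ _ (ih hu)
    have hut := hJ.torsionClosed hp hp2 B (by omega : 2 ≤ 3 + t) (by omega)
      (fun s hs => (hC s s (by omega) (by omega)).1)
      (fun s hs => (hC s s (by omega) (by omega)).2) _ u (ih hu)
    rw [← commutatorElement_inv]
    refine inv_mem (mem_torsionClosure
      (hJ.commutator_mem (by omega) le_rfl (by omega) huJ (htop s)) ?_)
    refine (hC 2 1 le_rfl le_rfl).2 i (t + 1) u (by convert huJ using 2; omega) s (htop s) ?_ hs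
    rwa [Nat.add_sub_add_right]

/-- Downward induction on `n`. The bounds for deeper terms make the `p^F`-th power multiplicative on
`γ_{n+1}(H)`, so generators suffice. A generator `z = ⁅u, y⁆` with `y^(p^i) = 1` is handled by
comparing `zy` with its conjugate `y`. -/
theorem pow_eq_one_of_lowerCentralSeries (hp : p.Prime) (hp2 : p ≠ 2) {i k ℓ : ℕ}
    (hkℓ : k ≤ ℓ * (p - 1))
    (hdeep : ∀ t, ∀ g ∈ (Subgroup.closure {x : G | x ^ p ^ i = 1}).lowerCentralSeries (k + 1 + t),
      g ^ p ^ (i - t) = 1) (d n : ℕ) (hd : k + 1 ≤ n + d) :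
    ∀ g ∈ (Subgroup.closure {x : G | x ^ p ^ i = 1}).lowerCentralSeries n,
      g ^ p ^ (i + ℓ - n / (p - 1)) = 1 := by
  set S : Set G := {x : G | x ^ p ^ i = 1} with hSdef
  set H := Subgroup.closure S with hH
  have hS : ∀ x ∈ S, ∀ g, g * x * g⁻¹ ∈ S := fun x hx g => by
    change (g * x * g⁻¹) ^ p ^ i = 1
    rw [conj_pow, show x ^ p ^ i = 1 from hx]; simp
  have hHn : H.Normal := closure_normal_of_conj hS
  have hp1 : 2 ≤ p - 1 := by
    have := hp.two_le
    omega
  have hlarge : ∀ n, k + 1 ≤ n → ∀ g ∈ H.lowerCentralSeries n,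
      g ^ p ^ (i + ℓ - n / (p - 1)) = 1 := by
    intro n hn g hg
    obtain ⟨t, rfl⟩ := Nat.exists_eq_add_of_le hn
    refine pow_prime_pow_eq_one_of_le (hdeep t g hg) ?_
    have : (k + 1 + t) / (p - 1) < ℓ + t + 1 := by
      rw [Nat.div_lt_iff_lt_mul (by omega)]
      nlinarith
    omega
  induction d generalizing n with
  | zero => exact hlarge n hd
  | succ d ih =>
    rcases lt_or_ge k n with hkn | hkn
    · exact hlarge n hkn
    set F := i + ℓ - n / (p - 1) with hF
    have hiF : i ≤ F := by
      have : n / (p - 1) ≤ ℓ := Nat.div_le_of_le_mul (by rw [mul_comm]; exact hkn.trans hkℓ)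
      omega
    have hmul : ∀ T : Subgroup G, (∀ m, 1 ≤ m → T.lowerCentralSeries m ≤
        H.lowerCentralSeries (n + m)) → ∀ x ∈ T, ∀ z ∈ T,
        (x * z) ^ p ^ F = x ^ p ^ F * z ^ p ^ F := by
      intro T hT x hx z hz
      refine mul_pow_of_hallPetrescu (fun m hm g hg => ?_) hx hz
      obtain ⟨v, hv, hdvd⟩ := exists_pow_sub_dvd_choose hp F m
      refine pow_eq_one_of_dvd (ih (n + m) (by omega) g (hT m hm hg))
        ((pow_dvd_pow p ?_).trans hdvd)
      -- The exponent gained by going `m` steps deeper pays for the `v` factors `p` missing from the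
      -- binomial coefficient.
      have : n / (p - 1) + v ≤ (n + m) / (p - 1) := by
        rw [← Nat.add_mul_div_left n v (by omega : 0 < p - 1)]
        exact Nat.div_le_div_right (by omega)
      omega
    have hgen : ∀ X : Set G, H.lowerCentralSeries n ≤ Subgroup.closure X →
        X ⊆ H.lowerCentralSeries n → (∀ x ∈ X, x ^ p ^ F = 1) →
        ∀ g ∈ H.lowerCentralSeries n, g ^ p ^ F = 1 := by
      intro X hX hX' hpow g hg
      have hle := (Subgroup.closure_le (H.lowerCentralSeries n)).2 hX'
      have hg' := hX hg
      clear hg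
      induction hg' using Subgroup.closure_induction with
      | mem x hx => exact hpow x hx
      | one => exact one_pow _
      | mul x y hx hy ihx ihy =>
        rw [hmul (H.lowerCentralSeries n)
          (fun m _ => lowerCentralSeries_lowerCentralSeries_le H n m) x (hle hx) y (hle hy),
          ihx, ihy, one_mul]
      | inv x _ ihx => rw [inv_pow, ihx, inv_one]
    cases n with
    | zero =>
      exact hgen S le_rfl Subgroup.subset_closure fun x hx => pow_prime_pow_eq_one_of_le hx hiF
    | succ n =>
      refine hgen _ (lowerCentralSeries_closure_succ_le hS n) ?_ ?_
      · rintro _ ⟨u, hu, s, hs, rfl⟩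
        exact Subgroup.commutator_mem_commutator hu (Subgroup.subset_closure hs)
      · rintro _ ⟨u, hu, y, hy, rfl⟩
        set z := ⁅u, y⁆ with hz
        have hyH : y ∈ H := Subgroup.subset_closure hy
        have hzH : z ∈ H.lowerCentralSeries (n + 1) :=
          Subgroup.commutator_mem_commutator hu hyH
        have hzy : ⁅z, y⁆ ∈ H.lowerCentralSeries (n + 1 + 1) :=
          Subgroup.commutator_mem_commutator hzH hyH
        have hT : ∀ m, 1 ≤ m → (Subgroup.closure {y, z}).lowerCentralSeries m ≤
            H.lowerCentralSeries (n + 1 + m) := fun m hm => by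
          refine lowerCentralSeries_closure_le (F := fun m => H.lowerCentralSeries (n + 1 + m))
            (fun m => lowerCentralSeries_normal hHn _) ?_ ?_ hm
          · rintro s (rfl | rfl) t (rfl | rfl)
            · rw [commutatorElement_self]; exact one_mem _
            · rw [← commutatorElement_inv]; exact inv_mem hzy
            · exact hzy
            · rw [commutatorElement_self]; exact one_mem _
          · intro m _ w hw s hs
            refine Subgroup.commutator_mem_commutator hw ?_
            rcases hs with rfl | rfl
            exacts [hyH, Subgroup.lowerCentralSeries_le_self H _ hzH]
        have hpow := hmul _ hT z (Subgroup.subset_closure (by simp)) y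
          (Subgroup.subset_closure (by simp))
        have hconj : z * y = u * y * u⁻¹ := by rw [hz, commutatorElement_def]; group
        rw [hconj, conj_pow, pow_prime_pow_eq_one_of_le hy hiF, mul_one, mul_one,
          mul_inv_cancel] at hpow
        exact hpow.symm

/-- The theorem for finite `p`-groups with a chain whose factors are powerfully embedded. -/
theorem pow_eq_one_of_mem_closure_torsion [Finite G] (hp : p.Prime) (hp2 : p ≠ 2)
    (hG : IsPGroup p G) {Q : ℕ → Subgroup G} (hn : ∀ j, (Q j).Normal) {k ℓ : ℕ} (h0 : Q 0 = ⊥)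
    (hk : Q k = ⊤)
    (hQ : ∀ j, ⁅Q (j + 1), (⊤ : Subgroup G)⁆ ≤ powerSubgroup p (Q (j + 1)) ⊔ Q j)
    (hkℓ : k ≤ ℓ * (p - 1)) {i : ℕ} {x : G}
    (hx : x ∈ Subgroup.closure {x : G | x ^ p ^ i = 1}) : x ^ p ^ (i + ℓ) = 1 := by
  have := Fact.mk hp
  have : Group.IsNilpotent G := hG.isNilpotent
  obtain ⟨N, hN, hNG, hlcs⟩ := exists_powerfullyEmbedded_of_chain hp hp2 hn h0 hk hQ
  obtain ⟨B, hJ⟩ := exists_isPowerFiltration hp hp2 hG hN hNG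
  have hC := fun b c (hb : 2 ≤ b) (hc : 1 ≤ c) =>
    hJ.commutator_torsion hp hp2 B hb hc (by omega)
  have := pow_eq_one_of_lowerCentralSeries hp hp2 (i := i) hkℓ (fun t g hg =>
    hJ.torsionClosed hp hp2 B (by omega : 2 ≤ 3 + t) (by omega)
      (fun s hs => (hC s s (by omega) (by omega)).1)
      (fun s hs => (hC s s (by omega) (by omega)).2) _ g
      (hJ.lowerCentralSeries_le_torsionClosure hp hp2 rfl hlcs t hg)) (k + 1) 0 (by omega) x hx
  simpa using this

end Exponent

/-! ### Pro-`p` groups -/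

section ProP

variable {G : Type*} [Group G] [TopologicalSpace G] [IsTopologicalGroup G] {p : ℕ}

/-- The elements of `G ⧸ N` central modulo the image of `W` form an open, hence closed, subgroup. It
contains each powerfully embedded subgroup, so also their closed product; that this product is
itself powerfully embedded is not needed. -/
theorem commutator_etaStep_le (N : Subgroup G) [N.Normal] {W : Subgroup G} (hWn : W.Normal)
    (hWo : IsOpen (W : Set G)) (hNW : N ≤ W) (hpow : ∀ x ∈ etaStep p N, x ^ p ∈ W) :
    ⁅etaStep p N, (⊤ : Subgroup G)⁆ ≤ W := by
  let ρ := QuotientGroup.mk' N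
  have hρ : Function.Surjective ρ := QuotientGroup.mk'_surjective N
  set V := W.map ρ with hV
  have hVo : IsOpen (V : Set (G ⧸ N)) := QuotientGroup.isOpenMap_coe _ hWo
  have hVn : V.Normal := hWn.map ρ hρ
  have hVc : IsClosed (V : Set (G ⧸ N)) := Subgroup.isClosed_of_isOpen V hVo
  set Z := (Subgroup.center ((G ⧸ N) ⧸ V)).comap (QuotientGroup.mk' V) with hZ
  have hmemZ : ∀ x, x ∈ Z ↔ ∀ g, ⁅x, g⁆ ∈ V := fun x => by
    rw [hZ, Subgroup.mem_comap, Subgroup.mem_center_iff,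
      (QuotientGroup.mk'_surjective V).forall]
    refine forall_congr' fun g => ?_
    rw [eq_comm, ← commutatorElement_eq_one_iff_mul_comm, ← map_commutatorElement]
    exact QuotientGroup.eq_one_iff _
  have hVZ : V ≤ Z := fun x hx => (hmemZ x).2 fun g =>
    Subgroup.commutator_le_left V ⊤ (Subgroup.commutator_mem_commutator hx (Subgroup.mem_top g))
  have hZc : IsClosed (Z : Set (G ⧸ N)) :=
    Subgroup.isClosed_of_isOpen Z (Subgroup.isOpen_mono hVZ hVo)
  have hle : etaSubgroup p (G ⧸ N) ≤ Z := by
    refine Subgroup.topologicalClosure_minimal _ (sSup_le fun M hM => ?_) hZc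
    have hMle : M ≤ etaSubgroup p (G ⧸ N) := (le_sSup hM).trans (Subgroup.le_topologicalClosure _)
    have hMV : M.closedPower p ≤ V := by
      refine Subgroup.topologicalClosure_minimal _ ((Subgroup.closure_le _).2 ?_) hVc
      rintro _ ⟨m, hm, rfl⟩
      obtain ⟨x, rfl⟩ := hρ m
      exact ⟨x ^ p, hpow x (hMle hm), map_pow ρ x p⟩
    intro x hx
    exact (hmemZ x).2 fun g => hMV (hM.commutator_le
      (Subgroup.commutator_mem_commutator hx (Subgroup.mem_top g)))
  rw [Subgroup.commutator_le]
  intro x hx g _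
  have h1 : ρ ⁅x, g⁆ ∈ V := by
    rw [map_commutatorElement]
    exact (hmemZ _).1 (hle hx) _
  have h2 : ⁅x, g⁆ ∈ V.comap ρ := h1
  rwa [hV, Subgroup.comap_map_eq, QuotientGroup.ker_mk', sup_eq_left.2 hNW] at h2

theorem upperEtaSeries_normal (p : ℕ) (G : Type*) [Group G] [TopologicalSpace G]
    [IsTopologicalGroup G] (j : ℕ) : (upperEtaSeries p G j).Normal :=
  (upperEtaSeriesAux p G j).2

theorem commutator_map_upperEtaSeries_le (p : ℕ) {U : Subgroup G} [U.Normal]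
    (hU : IsOpen (U : Set G)) (j : ℕ) :
    ⁅(upperEtaSeries p G (j + 1)).map (QuotientGroup.mk' U), (⊤ : Subgroup (G ⧸ U))⁆ ≤
      powerSubgroup p ((upperEtaSeries p G (j + 1)).map (QuotientGroup.mk' U)) ⊔
        (upperEtaSeries p G j).map (QuotientGroup.mk' U) := by
  let π := QuotientGroup.mk' U
  have hπ : Function.Surjective π := QuotientGroup.mk'_surjective U
  have hn := upperEtaSeries_normal p G
  have h1 := (hn j).map π hπ
  have h2 := powerSubgroup_normal p ((hn (j + 1)).map π hπ)
  set W := (powerSubgroup p ((upperEtaSeries p G (j + 1)).map π) ⊔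
    (upperEtaSeries p G j).map π).comap π with hW
  have hUW : U ≤ W := fun x hx => by
    rw [hW, Subgroup.mem_comap, show π x = 1 from (QuotientGroup.eq_one_iff x).2 hx]
    exact one_mem _
  have hWn : W.Normal := Subgroup.Normal.comap inferInstance π
  have := hn j
  have key : ⁅upperEtaSeries p G (j + 1), (⊤ : Subgroup G)⁆ ≤ W :=
    commutator_etaStep_le (p := p) (upperEtaSeries p G j) hWn (Subgroup.isOpen_mono hUW hU)
      (fun x hx => (le_sup_right : _ ≤ _ ⊔ (upperEtaSeries p G j).map π)
        (Subgroup.mem_map_of_mem π hx))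
      (fun x hx => (le_sup_left : powerSubgroup p ((upperEtaSeries p G (j + 1)).map π) ≤ _) (by
        rw [map_pow]
        exact pow_mem_powerSubgroup (Subgroup.mem_map_of_mem π hx)))
  rw [← Subgroup.map_top_of_surjective π hπ, ← Subgroup.map_commutator]
  exact Subgroup.map_le_iff_le_comap.2 key

theorem pow_mem_of_mem_closure_torsion (hp : p.Prime) (hp2 : p ≠ 2) (hG : IsProPGroup p G)
    {k ℓ : ℕ} (hk : upperEtaSeries p G k = ⊤) (hkℓ : k ≤ ℓ * (p - 1)) {i : ℕ} {x : G}
    (hx : x ∈ Subgroup.closure {x : G | x ^ p ^ i = 1}) {U : Subgroup G} (hUn : U.Normal)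
    (hU : IsOpen (U : Set G)) : x ^ p ^ (i + ℓ) ∈ U := by
  have := hG.compactSpace
  have := Fact.mk hp
  have hfin : Finite (G ⧸ U) := Subgroup.quotient_finite_of_isOpen U hU
  let π := QuotientGroup.mk' U
  have hπ : Function.Surjective π := QuotientGroup.mk'_surjective U
  obtain ⟨n, hn⟩ := hG.index_eq_pow U hUn hU
  have hpG : IsPGroup p (G ⧸ U) := IsPGroup.of_card (n := n) hn
  have hxU : π x ∈ Subgroup.closure {y : G ⧸ U | y ^ p ^ i = 1} := by
    have h1 : (Subgroup.closure {x : G | x ^ p ^ i = 1}).map π ≤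
        Subgroup.closure {y : G ⧸ U | y ^ p ^ i = 1} := by
      rw [MonoidHom.map_closure]
      refine Subgroup.closure_mono ?_
      rintro _ ⟨y, hy, rfl⟩
      change π y ^ p ^ i = 1
      rw [← map_pow, show y ^ p ^ i = 1 from hy, map_one]
    exact h1 ⟨x, hx, rfl⟩
  have := pow_eq_one_of_mem_closure_torsion hp hp2 hpG
    (Q := fun j => (upperEtaSeries p G j).map π) (k := k)
    (fun j => (upperEtaSeries_normal p G j).map π hπ) (Subgroup.map_bot π)
    (by simp only [hk]; exact Subgroup.map_top_of_surjective π hπ)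
    (commutator_map_upperEtaSeries_le p hU) hkℓ hxU
  rw [← map_pow] at this
  exact (QuotientGroup.eq_one_iff _).1 this

end ProP

end PowerfulClass

theorem theoremt (p : ℕ) [Fact p.Prime] (hp : p ≠ 2)
    (G : Type*) [Group G] [TopologicalSpace G] [IsTopologicalGroup G]
    (hG : IsProPGroup p G) (hfg : IsTopologicallyFinitelyGenerated G)
    (k ℓ : ℕ) (hk : HasPowerfulClass p G k) (hkℓ : k ≤ ℓ * (p - 1)) (i : ℕ) :
    (omegaSubgroup p G i).closedPower (p ^ (i + ℓ)) = ⊥ := by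
  have := hG.compactSpace
  have := hG.t2Space
  have := hG.totallyDisconnectedSpace
  have hmain : ∀ x ∈ Subgroup.closure {x : G | x ^ p ^ i = 1}, x ^ p ^ (i + ℓ) = 1 := by
    intro x hx
    -- In a profinite group a nontrivial element avoids some open normal subgroup.
    by_contra hne
    obtain ⟨U, hU⟩ := ProfiniteGrp.exist_openNormalSubgroup_sub_open_nhds_of_one
      (isOpen_compl_singleton (x := x ^ p ^ (i + ℓ))) (fun h => hne h.symm)
    exact hU (PowerfulClass.pow_mem_of_mem_closure_torsion Fact.out hp hG hk.1 hkℓ hx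
      U.isNormal' U.isOpen') rfl
  have hclosed : IsClosed {x : G | x ^ p ^ (i + ℓ) = 1} :=
    isClosed_eq (continuous_pow _) continuous_const
  have hbot : IsClosed ((⊥ : Subgroup G) : Set G) := by
    rw [Subgroup.coe_bot]; exact isClosed_singleton
  rw [eq_bot_iff]
  refine Subgroup.topologicalClosure_minimal _ ((Subgroup.closure_le _).2 ?_) hbot
  rintro _ ⟨x, hx, rfl⟩
  exact closure_minimal hmain hclosed hx
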